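/- For positive integers $k,d,n$ let $F_{k,d}(n)$ be the maximal size of a set $A\subseteq\{1,2,\ldots,n\}$ such that the equation \[ a_1a_2\cdots a_k=x^d,\qquad a_1<a_2<\cdots<a_k, \] has no solution with $a_1,\ldots,a_k\in A$ and $x$ an integer, and let $\pi(y)$ denote the number of primes not exceeding $y$. Theorem. There is an $n_0$ such that for all integers $n\ge n_0$ \[ \frac{n^{5/6}}{(\log n)^{5/3}} < F_{9,3}(n)-\left(\pi(n)+\pi\left(\tfrac n2\right)\right), \] and there is an absolute constant $C>0$ such that for all integers $n\ge 1$ \[ F_{9,3}(n)-\left(\pi(n)+\pi\left(\tfrac n2\right)\right)\le C\,n^{5/6}. \] -/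

import Mathlib

/-- `A` has property `P_{k,d}`: the equation `a₁ a₂ ⋯ a_k = x ^ d` has no solution with
`a₁ < a₂ < ⋯ < a_k` in `A` and `x` an integer. -/
def PropertyP (k d : ℕ) (A : Set ℕ) : Prop :=
  ¬ ∃ (a : Fin k → ℕ) (x : ℤ),
    StrictMono a ∧ (∀ i, a i ∈ A) ∧ ∏ i, (a i : ℤ) = x ^ d

open Classical in
/-- `F_{k,d}(n)`: the maximal size of a subset of `{1, …, n}` with property `P_{k,d}`. -/
noncomputable def maxSizeF (k d n : ℕ) : ℕ :=
  ((Finset.Icc 1 n).powerset.filter fun A : Finset ℕ => PropertyP k d (A : Set ℕ)).sup Finset.card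

/-! Upper bound. Each `a ≤ n` factors as `u * v` with `v ≤ u`, where `u` is prime or `u ≤ n^(2/3)`;
choosing one factorization for each element turns `A` into a bipartite graph on the pairs `(u, v)`.
A `K_{3,3}` in it gives nine distinct elements with product `(∏ L * ∏ R) ^ 3`, so the graph has
none. Now cut each degree at 2. A prime `u > n / 2` has at most the neighbour `1`, so the truncated
degrees of the prime `u` add up to at most `π(n) + π(n / 2)`, while the `u ≤ n^(2/3)` add only
`O(n^(2/3))`. The degrees beyond 2 are controlled by a weighted Kővári–Sós–Turán count, which gives
`O(n^(5/6))` (`card_le_sum_min_add`, `sum_min_card_le`).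

Lower bound. Take the primes `p` in `(y, n]`, the doubles `2p` of primes in `(y, n / 2]`, with `y`
about `2√n`, and products of two primes up to `y` that are the edges of a `K_{3,3}`-free graph. A
prime above `y` divides only `p` and `2p`, hence never occurs to a positive power divisible by 3. A
solution thus consists of nine edges with all degrees divisible by 3, which forces a `K_{3,3}`
(`propertyP_nine_three`). Projective norm graphs (`exists_k33Free_subset`) supply order `(√n / log
n)^(5/3)` edges, which beats the `O(√n)` lost by dropping the primes up to `y`. The explicit
constant 1 in the bound needs explicit Chebyshev estimates (`eventually_theta_bounds`). -/

open Finset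

/-! ### Factor pairs, and solutions as copies of `K_{3,3}`. -/

/-- Take the least divisor `d` of `a` with `d ^ 3 ≥ n`. Its cofactor is at most `n^(2/3)`. If `d` is
composite with least prime factor `p`, then `p ≤ d / p`, and `d / p` is below `n^(1/3)` by
minimality, so `d < n^(2/3)`. -/
lemma cover_by_factor_pair {n a : ℕ} (ha : 1 ≤ a) (han : a ≤ n) :
    ∃ u v : ℕ, u * v = a ∧ v ≤ u ∧ (u ^ 3 ≤ n ^ 2 ∨ u.Prime) := by
  have key : ∃ u v : ℕ, u * v = a ∧ (u ^ 3 ≤ n ^ 2 ∨ u.Prime) ∧ (v ^ 3 ≤ n ^ 2 ∨ v ≤ u) := by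
    by_cases h : n ≤ a ^ 3
    · have hex : ∃ d, d ∣ a ∧ n ≤ d ^ 3 := ⟨a, dvd_rfl, h⟩
      classical
      obtain ⟨d, ⟨hd, hdn⟩, hmin⟩ : ∃ d, (d ∣ a ∧ n ≤ d ^ 3) ∧
          ∀ m < d, ¬ (m ∣ a ∧ n ≤ m ^ 3) :=
        ⟨Nat.find hex, Nat.find_spec hex, fun m => Nat.find_min hex⟩
      obtain ⟨e, rfl⟩ := hd
      have hd0 : 0 < d := Nat.pos_of_mul_pos_right ha
      have he0 : 0 < e := Nat.pos_of_mul_pos_left ha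
      have hn0 : 0 < n := ha.trans han
      have he : e ^ 3 ≤ n ^ 2 := by
        have h1 : n * e ^ 3 ≤ n * n ^ 2 := by
          calc n * e ^ 3 ≤ d ^ 3 * e ^ 3 := Nat.mul_le_mul_right _ hdn
            _ = (d * e) ^ 3 := by ring
            _ ≤ n ^ 3 := Nat.pow_le_pow_left han 3
            _ = n * n ^ 2 := by ring
        exact Nat.le_of_mul_le_mul_left h1 hn0
      refine ⟨d, e, rfl, ?_, Or.inl he⟩
      by_cases hp : d.Prime
      · exact Or.inr hp
      left
      by_cases hd1 : d = 1
      · rw [hd1, one_pow]; exact Nat.one_le_pow _ _ hn0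
      have hd2 : 2 ≤ d := by omega
      obtain ⟨f, hf⟩ := Nat.minFac_dvd d
      have hpp := Nat.minFac_prime hd1
      have hsq := Nat.minFac_sq_le_self hd0 hp
      set p := d.minFac
      have hpf : p ≤ f := by
        rw [hf, sq] at hsq
        exact Nat.le_of_mul_le_mul_left hsq hpp.pos
      have hfd : f < d := by
        have := hpp.two_le
        nlinarith
      have hfn : f ^ 3 < n := by
        by_contra hc
        exact hmin f hfd ⟨(Dvd.intro_left p hf.symm).mul_right e, by omega⟩
      have hpn : p ^ 3 ≤ n := (Nat.pow_le_pow_left hpf 3).trans hfn.le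
      calc d ^ 3 = p ^ 3 * f ^ 3 := by rw [hf]; ring
        _ ≤ n * n := Nat.mul_le_mul hpn hfn.le
        _ = n ^ 2 := by ring
    · refine ⟨a, 1, by simp, Or.inl ?_, Or.inr ha⟩
      nlinarith
  -- Order the two factors; a swap is needed only when the cofactor is the larger, and then it is at
  -- most `n^(2/3)`.
  obtain ⟨u, v, huv, hu, hv⟩ := key
  rcases le_total v u with h | h
  · exact ⟨u, v, huv, h, hu⟩
  · rcases hv with hv | hv
    · exact ⟨v, u, by rw [mul_comm, huv], h, Or.inl hv⟩
    · exact ⟨u, v, huv, hv, hu⟩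

/-- A finite bipartite graph, given by its set of edges, without a complete `3 × 3` subgraph. -/
def K33Free {α β : Type*} (E : Finset (α × β)) : Prop :=
  ∀ (L : Finset α) (R : Finset β), L.card = 3 → R.card = 3 → ¬ L ×ˢ R ⊆ E

lemma k33Free_of_propertyP {A : Finset ℕ} (hA : PropertyP 9 3 (A : Set ℕ)) {E : Finset (ℕ × ℕ)}
    (hE : ∀ e ∈ E, e.1 * e.2 ∈ A) (hinj : Set.InjOn (fun e : ℕ × ℕ => e.1 * e.2) E) :
    K33Free E := by
  intro L R hL hR hLR
  apply hA
  have hinj' : Set.InjOn (fun e : ℕ × ℕ => e.1 * e.2) (L ×ˢ R : Finset (ℕ × ℕ)) :=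
    hinj.mono (by exact_mod_cast hLR)
  set T := (L ×ˢ R).image (fun e : ℕ × ℕ => e.1 * e.2) with hTdef
  have hT : T.card = 9 := by
    rw [hTdef, Finset.card_image_of_injOn hinj', Finset.card_product, hL, hR]
  refine ⟨T.orderEmbOfFin hT, (((∏ u ∈ L, u) * ∏ v ∈ R, v : ℕ) : ℤ),
    (T.orderEmbOfFin hT).strictMono, fun i => ?_, ?_⟩
  · have := T.orderEmbOfFin_mem hT i
    obtain ⟨e, he, h⟩ := Finset.mem_image.1 this
    rw [← h]
    exact hE e (hLR he)
  · have h1 : ∏ i, T.orderEmbOfFin hT i = ∏ x ∈ T, x := by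
      rw [← Finset.prod_coe_sort T (fun x => x)]
      exact Fintype.prod_equiv (T.orderIsoOfFin hT).toEquiv _ _ (fun i => rfl)
    have h2 : ∏ x ∈ T, x = ((∏ u ∈ L, u) * ∏ v ∈ R, v) ^ 3 := by
      rw [hTdef, Finset.prod_image hinj', Finset.prod_product]
      have h3 : ∀ x ∈ L, ∏ y ∈ R, x * y = x ^ 3 * ∏ y ∈ R, y := fun x _ => by
        rw [Finset.prod_mul_distrib, Finset.prod_const, hR]
      rw [Finset.prod_congr rfl h3, Finset.prod_mul_distrib, Finset.prod_const, Finset.prod_pow, hL]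
      ring
    exact_mod_cast h1.trans h2

/-! ### Power sums and truncated degrees. -/

lemma sum_powersetCard_prod_le {ι : Type*} [DecidableEq ι] (s : Finset ι) (f : ι → ℝ)
    (hf : ∀ i ∈ s, 0 ≤ f i) (k : ℕ) :
    ∑ T ∈ s.powersetCard k, ∏ i ∈ T, f i ≤ (∑ i ∈ s, f i) ^ k := by
  induction s using Finset.induction_on generalizing k with
  | empty =>
    cases k with
    | zero => simp
    | succ k => rw [powersetCard_eq_empty.2 (by simp)]; simp
  | insert a s ha ih =>
    have hs : ∀ i ∈ s, 0 ≤ f i := fun i hi => hf i (mem_insert_of_mem hi)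
    have hfa : 0 ≤ f a := hf a (mem_insert_self a s)
    have hS : 0 ≤ ∑ i ∈ s, f i := sum_nonneg hs
    cases k with
    | zero => simp
    | succ k =>
      rw [powersetCard_succ_insert ha, sum_union, sum_image, sum_insert ha]
      · have h1 : ∑ T ∈ s.powersetCard k, ∏ i ∈ insert a T, f i
            = f a * ∑ T ∈ s.powersetCard k, ∏ i ∈ T, f i := by
          rw [mul_sum]
          refine sum_congr rfl fun T hT => prod_insert fun h => ha ((mem_powersetCard.1 hT).1 h)
        rw [h1]
        calc _ ≤ (∑ i ∈ s, f i) ^ (k + 1) + f a * (∑ i ∈ s, f i) ^ k := by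
              gcongr
              · exact ih hs _
              · exact ih hs _
          _ = (f a + ∑ i ∈ s, f i) * (∑ i ∈ s, f i) ^ k := by ring
          _ ≤ (f a + ∑ i ∈ s, f i) * (f a + ∑ i ∈ s, f i) ^ k := by
              gcongr
              linarith
          _ = _ := by ring
      · intro T hT T' hT' h
        have h1 := fun h' => ha ((mem_powersetCard.1 hT).1 h')
        have h2 := fun h' => ha ((mem_powersetCard.1 hT').1 h')
        rw [← erase_insert h1, ← erase_insert h2, h]
      · rw [disjoint_left]
        intro T hT hT'
        obtain ⟨T', -, rfl⟩ := mem_image.1 hT'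
        exact ha ((mem_powersetCard.1 hT).1 (mem_insert_self a T'))

/-- Bernoulli's inequality `(1 - 1 / v) ^ r ≤ 1 - r / v`, multiplied by `v ^ r`; it replaces the
comparison with an integral. -/
lemma rpow_neg_le_telescope {v : ℝ} (hv : 1 ≤ v) {r : ℝ} (hr0 : 0 < r) (hr1 : r ≤ 1) :
    r * v ^ (r - 1) ≤ v ^ r - (v - 1) ^ r := by
  have hv0 : 0 < v := by linarith
  have hv1 : 1 / v ≤ 1 := by rw [div_le_one hv0]; exact hv
  have h1 : (v - 1) ^ r = v ^ r * (1 + -(1 / v)) ^ r := by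
    rw [← Real.mul_rpow hv0.le]
    · congr 1; field_simp; ring
    · linarith
  have h2 := rpow_one_add_le_one_add_mul_self (s := -(1 / v)) (p := r)
    (by linarith) hr0.le hr1
  have h3 : v ^ (r - 1) = v ^ r * (1 / v) := by
    rw [Real.rpow_sub hv0, Real.rpow_one]; ring
  rw [h1, h3]
  have := Real.rpow_pos_of_pos hv0 r
  nlinarith

lemma sum_Icc_rpow_sub_one_le (m : ℕ) {r : ℝ} (hr0 : 0 < r) (hr1 : r ≤ 1) :
    r * ∑ v ∈ Icc 1 m, (v : ℝ) ^ (r - 1) ≤ (m : ℝ) ^ r := by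
  induction m with
  | zero => simp [hr0.ne']
  | succ m ih =>
    rw [sum_Icc_succ_top (by omega), mul_add]
    have := rpow_neg_le_telescope (v := (m + 1 : ℕ)) (by simp) hr0 hr1
    push_cast at this ⊢
    rw [add_sub_cancel_right] at this
    linarith

lemma rpow_neg_sub_one_le_telescope {v : ℝ} (hv : 1 < v) {r : ℝ} (hr0 : 0 < r) (hr1 : r ≤ 1) :
    r * v ^ (-r - 1) ≤ (v - 1) ^ (-r) - v ^ (-r) := by
  have hv0 : 0 < v := by linarith
  have hv1 : 0 < v - 1 := by linarith
  have h := rpow_neg_le_telescope hv.le hr0 hr1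
  have ha := Real.rpow_pos_of_pos hv0 r
  have hb := Real.rpow_pos_of_pos hv1 r
  have hba : (v - 1) ^ r ≤ v ^ r := Real.rpow_le_rpow hv1.le (by linarith) hr0.le
  have e1 : v ^ (-r - 1) = v ^ (r - 1) / (v ^ r * v ^ r) := by
    rw [← Real.rpow_add hv0, ← Real.rpow_sub hv0]; congr 1; ring
  rw [e1, Real.rpow_neg hv1.le, Real.rpow_neg hv0.le, inv_sub_inv hb.ne' ha.ne', mul_div_assoc']
  calc _ ≤ (v ^ r - (v - 1) ^ r) / (v ^ r * v ^ r) := by gcongr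
    _ ≤ _ := by gcongr

lemma sum_Ioc_rpow_neg_sub_one_le {m N : ℕ} (hm : 1 ≤ m) (hmN : m ≤ N) {r : ℝ}
    (hr0 : 0 < r) (hr1 : r ≤ 1) :
    r * ∑ v ∈ Ioc m N, (v : ℝ) ^ (-r - 1) ≤ (m : ℝ) ^ (-r) - (N : ℝ) ^ (-r) := by
  induction N, hmN using Nat.le_induction with
  | base => simp
  | succ N hN ih =>
    rw [sum_Ioc_succ_top (by omega), mul_add]
    have := rpow_neg_sub_one_le_telescope (v := (N + 1 : ℕ))
      (by exact_mod_cast Nat.lt_add_one_iff.2 (hm.trans hN)) hr0 hr1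
    push_cast at this ⊢
    rw [add_sub_cancel_right] at this
    linarith

/-- With `x = d - 2` one has `x ^ 3 ≤ 6 * d.choose 3`, so either `x ≤ t` or `x ≤ x ^ 3 / t ^ 2`.
Splitting off exactly 2 matters: this term yields the main term `π(n) + π(n / 2)`. -/
lemma card_le_add_choose_div (d : ℕ) {t : ℝ} (ht : 0 < t) :
    (d : ℝ) ≤ (min d 2 : ℕ) + (t + 6 * (d.choose 3 : ℝ) / t ^ 2) := by
  have hc : (0 : ℝ) ≤ 6 * (d.choose 3 : ℝ) / t ^ 2 := by positivity
  rcases le_total d 2 with h | h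
  · rw [min_eq_left h]; linarith
  obtain ⟨x, rfl⟩ := Nat.exists_eq_add_of_le h
  rw [min_eq_right h]
  have h6 : x ^ 3 ≤ 6 * (2 + x).choose 3 := by
    have := Nat.descFactorial_eq_factorial_mul_choose (2 + x) 3
    have h3 : Nat.factorial 3 = 6 := rfl
    rw [h3] at this
    rw [← this, show 2 + x = x + 2 by ring]
    cases x with
    | zero => simp
    | succ x =>
      simp only [Nat.descFactorial_succ, Nat.descFactorial_zero]
      have e1 : x + 1 + 2 - 2 = x + 1 := by omega
      have e2 : x + 1 + 2 - 1 = x + 2 := by omega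
      rw [e1, e2, Nat.sub_zero]
      nlinarith
  have h6' : (x : ℝ) ^ 3 ≤ 6 * ((2 + x).choose 3 : ℝ) := by exact_mod_cast h6
  push_cast
  by_cases hx : (x : ℝ) ≤ t
  · linarith
  · push Not at hx
    have : (x : ℝ) ≤ 6 * ((2 + x).choose 3 : ℝ) / t ^ 2 := by
      rw [le_div_iff₀ (by positivity)]
      have : (x : ℝ) * t ^ 2 ≤ x * x ^ 2 := by gcongr
      nlinarith
    linarith

/-! ### The weighted Kővári–Sós–Turán bound. -/

/-- The neighbourhood of `u` in a bipartite graph. -/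
def rightNbhd {α β : Type*} [DecidableEq α] [DecidableEq β] (E : Finset (α × β)) (u : α) :
    Finset β :=
  (E.filter fun e => e.1 = u).image Prod.snd

lemma mem_rightNbhd {α β : Type*} [DecidableEq α] [DecidableEq β] {E : Finset (α × β)} {u : α}
    {v : β} : v ∈ rightNbhd E u ↔ (u, v) ∈ E := by
  simp [rightNbhd]

lemma card_eq_sum_card_rightNbhd {α β : Type*} [DecidableEq α] [DecidableEq β]
    {E : Finset (α × β)} {U : Finset α} (hU : ∀ e ∈ E, e.1 ∈ U) :
    E.card = ∑ u ∈ U, (rightNbhd E u).card := by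
  rw [card_eq_sum_card_fiberwise (f := Prod.fst) (t := U) (fun e he => hU e he)]
  refine sum_congr rfl fun u _ => ?_
  rw [rightNbhd, card_image_of_injOn]
  intro e he e' he' h
  simp only [coe_filter, Set.mem_ofPred_eq] at he he'
  exact Prod.ext (he.2.trans he'.2.symm) h

/-- A weighted form of the Kővári–Sós–Turán count for graphs without `K_{3,3}`. -/
lemma sum_choose_div_le {α β : Type*} [DecidableEq α] [DecidableEq β] {E : Finset (α × β)}
    (hE : K33Free E) (U : Finset α) (V : Finset β) (hV : ∀ e ∈ E, e.2 ∈ V) (w : α → ℝ)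
    (f : β → ℝ) (hf : ∀ v ∈ V, 0 ≤ f v) {c : ℝ} (hc : 0 ≤ c)
    (hwf : ∀ u ∈ U, ∀ T ⊆ rightNbhd E u, T.card = 3 → w u ≤ c * ∏ v ∈ T, f v) :
    ∑ u ∈ U, ((rightNbhd E u).card.choose 3 : ℝ) * w u ≤ 2 * c * (∑ v ∈ V, f v) ^ 3 := by
  have hsub : ∀ u, rightNbhd E u ⊆ V := fun u v hv => hV _ (mem_rightNbhd.1 hv)
  have h1 : ∀ u ∈ U, ((rightNbhd E u).card.choose 3 : ℝ) * w u =
      ∑ T ∈ V.powersetCard 3, if T ⊆ rightNbhd E u then w u else 0 := by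
    intro u _
    rw [← sum_filter, sum_const, nsmul_eq_mul, ← card_powersetCard]
    congr 3
    ext T
    simp only [mem_powersetCard, mem_filter]
    exact ⟨fun h => ⟨⟨h.1.trans (hsub u), h.2⟩, h.1⟩, fun h => ⟨h.2, h.1.2⟩⟩
  rw [sum_congr rfl h1, sum_comm]
  calc _ ≤ ∑ T ∈ V.powersetCard 3, 2 * (c * ∏ v ∈ T, f v) := by
        refine sum_le_sum fun T hT => ?_
        obtain ⟨hTV, hT3⟩ := mem_powersetCard.1 hT
        rw [← sum_filter]
        -- Three common neighbours of the triple `T` would complete a `K_{3,3}`.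
        have hcard : (U.filter fun u => T ⊆ rightNbhd E u).card ≤ 2 := by
          by_contra! h
          obtain ⟨L, hL, hL3⟩ := exists_subset_card_eq (Nat.succ_le_of_lt h)
          refine hE L T hL3 hT3 fun e he => ?_
          obtain ⟨he1, he2⟩ := mem_product.1 he
          exact mem_rightNbhd.1 ((mem_filter.1 (hL he1)).2 he2)
        have hp : 0 ≤ c * ∏ v ∈ T, f v :=
          mul_nonneg hc (prod_nonneg fun v hv => hf v (hTV hv))
        calc _ ≤ ∑ u ∈ U.filter (fun u => T ⊆ rightNbhd E u), c * ∏ v ∈ T, f v :=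
              sum_le_sum fun u hu => hwf u (mem_filter.1 hu).1 T (mem_filter.1 hu).2 hT3
          _ = ((U.filter fun u => T ⊆ rightNbhd E u).card : ℝ) * (c * ∏ v ∈ T, f v) := by
              rw [sum_const, nsmul_eq_mul]
          _ ≤ _ := by gcongr; exact_mod_cast hcard
    _ = 2 * c * ∑ T ∈ V.powersetCard 3, ∏ v ∈ T, f v := by
        rw [mul_sum]; exact sum_congr rfl fun T _ => by ring
    _ ≤ _ := by gcongr; exact sum_powersetCard_prod_le V f hf 3

/-- The threshold degree used for the vertex `u`. -/
noncomputable def degThreshold (n u : ℕ) : ℝ :=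
  if u ^ 2 ≤ n then (n : ℝ) ^ (1 / 3 : ℝ) else (n : ℝ) * (u : ℝ) ^ (-(4 / 3) : ℝ)

lemma degThreshold_pos {n u : ℕ} (hn : 1 ≤ n) (hu : 1 ≤ u) : 0 < degThreshold n u := by
  have : (0 : ℝ) < n := by exact_mod_cast hn
  have : (0 : ℝ) < u := by exact_mod_cast hu
  unfold degThreshold
  split_ifs <;> positivity

lemma sum_degThreshold_le {n : ℕ} (hn : 1 ≤ n) :
    ∑ u ∈ Icc 1 n, degThreshold n u ≤ 7 * (n : ℝ) ^ (5 / 6 : ℝ) := by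
  have hn0 : (0 : ℝ) < n := by exact_mod_cast hn
  set m := Nat.sqrt n with hm
  have hm1 : 1 ≤ m := Nat.sqrt_pos.2 hn
  have hmn : m ≤ n := Nat.sqrt_le_self n
  have hm0 : (0 : ℝ) < m := by exact_mod_cast hm1
  have hmsq : (m : ℝ) ≤ (n : ℝ) ^ (1 / 2 : ℝ) := by
    rw [← Real.sqrt_eq_rpow]; exact Real.nat_sqrt_le_real_sqrt
  have hmge : (n : ℝ) ^ (1 / 2 : ℝ) ≤ 2 * m := by
    rw [← Real.sqrt_eq_rpow]
    have := Real.real_sqrt_le_nat_sqrt_succ (a := n)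
    have h1 : (1 : ℝ) ≤ m := by exact_mod_cast hm1
    linarith
  have hunion : Icc 1 n = Icc 1 m ∪ Ioc m n := by
    ext x; simp only [mem_Icc, mem_union, mem_Ioc]; omega
  have hdisj : Disjoint (Icc 1 m) (Ioc m n) := by
    rw [disjoint_left]; intro x; simp only [mem_Icc, mem_Ioc]; omega
  rw [hunion, sum_union hdisj]
  -- The two ranges meet at `u = √n`, and both are of order `n^(5/6)`.
  have h1 : ∑ u ∈ Icc 1 m, degThreshold n u ≤ (n : ℝ) ^ (5 / 6 : ℝ) := by
    have : ∀ u ∈ Icc 1 m, degThreshold n u = (n : ℝ) ^ (1 / 3 : ℝ) := fun u hu => by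
      rw [degThreshold, if_pos]
      rw [pow_two]
      exact Nat.le_sqrt.1 (mem_Icc.1 hu).2
    rw [sum_congr rfl this, sum_const, nsmul_eq_mul, Nat.card_Icc, Nat.add_sub_cancel]
    calc (m : ℝ) * (n : ℝ) ^ (1 / 3 : ℝ) ≤ (n : ℝ) ^ (1 / 2 : ℝ) * (n : ℝ) ^ (1 / 3 : ℝ) := by
          gcongr
      _ = _ := by rw [← Real.rpow_add hn0]; norm_num
  have h2 : ∑ u ∈ Ioc m n, degThreshold n u ≤ 6 * (n : ℝ) ^ (5 / 6 : ℝ) := by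
    have : ∀ u ∈ Ioc m n, degThreshold n u = n * (u : ℝ) ^ (-(1 / 3) - 1 : ℝ) := fun u hu => by
      rw [degThreshold, if_neg]
      · norm_num
      · rw [pow_two]
        exact fun h => absurd (Nat.le_sqrt.2 h) (not_le.2 (mem_Ioc.1 hu).1)
    rw [sum_congr rfl this, ← mul_sum]
    have hs := sum_Ioc_rpow_neg_sub_one_le hm1 hmn (r := 1 / 3) (by norm_num) (by norm_num)
    have hpos : (0 : ℝ) ≤ (n : ℝ) ^ (-(1 / 3) : ℝ) := by positivity
    have hmm : (m : ℝ) ^ (-(1 / 3) : ℝ) ≤ 2 * (n : ℝ) ^ (-(1 / 6) : ℝ) := by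
      calc (m : ℝ) ^ (-(1 / 3) : ℝ) ≤ ((n : ℝ) ^ (1 / 2 : ℝ) / 2) ^ (-(1 / 3) : ℝ) := by
            apply Real.rpow_le_rpow_of_nonpos (by positivity) (by linarith) (by norm_num)
        _ = (n : ℝ) ^ (-(1 / 6) : ℝ) * (2 : ℝ) ^ (1 / 3 : ℝ) := by
            rw [Real.div_rpow (by positivity) (by norm_num), ← Real.rpow_mul hn0.le,
              Real.rpow_neg (by norm_num : (0:ℝ) ≤ 2)]
            norm_num
        _ ≤ (n : ℝ) ^ (-(1 / 6) : ℝ) * 2 := by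
            gcongr
            calc (2 : ℝ) ^ (1 / 3 : ℝ) ≤ 2 ^ (1 : ℝ) :=
                  Real.rpow_le_rpow_of_exponent_le (by norm_num) (by norm_num)
              _ = 2 := Real.rpow_one 2
        _ = _ := by ring
    have hprod : (n : ℝ) ^ (5 / 6 : ℝ) = n * (n : ℝ) ^ (-(1 / 6) : ℝ) := by
      conv_rhs => rw [← Real.rpow_one_add' hn0.le (by norm_num)]
      norm_num
    rw [hprod]
    nlinarith
  linarith

/-- Every neighbour `v` of `u` is at most `y = min (√n) (n / u)`. The threshold is chosen so that `1
/ t ^ 2 = n^(2/3) * y^(-8/3)`, which splits into three factors `y^(-8/9)`, one for each vertex of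
the triple. -/
lemma inv_sq_degThreshold_le {n u a b c : ℕ} (hn : 1 ≤ n) (hu : 1 ≤ u) (ha : 1 ≤ a)
    (hb : 1 ≤ b) (hc : 1 ≤ c) (hua : u * a ≤ n) (hub : u * b ≤ n) (huc : u * c ≤ n)
    (hau : a ≤ u) (hbu : b ≤ u) (hcu : c ≤ u) :
    1 / degThreshold n u ^ 2 ≤ (n : ℝ) ^ (2 / 3 : ℝ) *
      ((a : ℝ) ^ (1 / 9 - 1 : ℝ) * (b : ℝ) ^ (1 / 9 - 1 : ℝ) * (c : ℝ) ^ (1 / 9 - 1 : ℝ)) := by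
  have hn0 : (0 : ℝ) < n := by exact_mod_cast hn
  have hu0 : (0 : ℝ) < u := by exact_mod_cast hu
  have hbound : ∀ x : ℕ, 1 ≤ x → u * x ≤ n → x ≤ u →
      ((if u ^ 2 ≤ n then (n : ℝ) ^ (1 / 2 : ℝ) else n / u) : ℝ) ^ (-(8 / 9) : ℝ) ≤
        (x : ℝ) ^ (1 / 9 - 1 : ℝ) := by
    intro x hx hux hxu
    have hx0 : (0 : ℝ) < x := by exact_mod_cast hx
    rw [show (1 / 9 - 1 : ℝ) = -(8 / 9) by norm_num]
    apply Real.rpow_le_rpow_of_nonpos hx0 _ (by norm_num)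
    split_ifs with h
    · rw [← Real.sqrt_eq_rpow]
      apply Real.le_sqrt_of_sq_le
      have : x ^ 2 ≤ n := (Nat.pow_le_pow_left hxu 2).trans h
      exact_mod_cast this
    · rw [le_div_iff₀ hu0, mul_comm]
      exact_mod_cast hux
  have hA := hbound a ha hua hau
  have hB := hbound b hb hub hbu
  have hC := hbound c hc huc hcu
  set y : ℝ := if u ^ 2 ≤ n then (n : ℝ) ^ (1 / 2 : ℝ) else n / u with hy
  have hy0 : 0 < y := by rw [hy]; split_ifs <;> positivity
  have hyp : 0 < y ^ (-(8 / 9) : ℝ) := by positivity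
  calc 1 / degThreshold n u ^ 2 = (n : ℝ) ^ (2 / 3 : ℝ) *
        (y ^ (-(8 / 9) : ℝ) * y ^ (-(8 / 9) : ℝ) * y ^ (-(8 / 9) : ℝ)) := by
        rw [← Real.rpow_add hy0, ← Real.rpow_add hy0, hy, degThreshold]
        split_ifs with h
        · rw [← Real.rpow_natCast, ← Real.rpow_mul hn0.le, ← Real.rpow_mul hn0.le,
            ← Real.rpow_add hn0, one_div, ← Real.rpow_neg hn0.le]
          norm_num
        · rw [mul_pow, ← Real.rpow_natCast ((u : ℝ) ^ _), ← Real.rpow_mul hu0.le,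
            Real.div_rpow hn0.le hu0.le, mul_div_assoc', ← Real.rpow_add hn0, one_div, mul_inv,
            ← Real.rpow_neg hu0.le, div_eq_mul_inv _ ((u : ℝ) ^ _), ← Real.rpow_neg hu0.le,
            ← Real.rpow_natCast (n : ℝ), ← Real.rpow_neg hn0.le]
          norm_num
    _ ≤ _ := by gcongr

/-- The weights `v^(-8/9)` sum over `v ≤ √n` to at most `9 * n^(1/18)`, so the triples contribute `2
* 9 ^ 3 = 1458` times `n^(5/6)`. The constant is `7 + 6 * 1458`. -/
lemma card_le_sum_min_add {n : ℕ} (hn : 1 ≤ n) {E : Finset (ℕ × ℕ)} (hE : K33Free E)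
    (hpos : ∀ e ∈ E, 1 ≤ e.2) (hle : ∀ e ∈ E, e.2 ≤ e.1) (hmul : ∀ e ∈ E, e.1 * e.2 ≤ n) :
    (E.card : ℝ) ≤ (∑ u ∈ Icc 1 n, min (rightNbhd E u).card 2 : ℕ) +
      8755 * (n : ℝ) ^ (5 / 6 : ℝ) := by
  have hn0 : (0 : ℝ) < n := by exact_mod_cast hn
  have hU : ∀ e ∈ E, e.1 ∈ Icc 1 n := fun e he => by
    have h1 := hpos e he
    have h2 := hle e he
    have h3 := hmul e he
    exact mem_Icc.2 ⟨h1.trans h2, (Nat.le_mul_of_pos_right _ h1).trans h3⟩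
  have hV : ∀ e ∈ E, e.2 ∈ Icc 1 (Nat.sqrt n) := fun e he =>
    mem_Icc.2 ⟨hpos e he, Nat.le_sqrt.2 ((Nat.mul_le_mul_right _ (hle e he)).trans (hmul e he))⟩
  have hchoose := sum_choose_div_le hE (Icc 1 n) (Icc 1 (Nat.sqrt n)) hV
    (fun u => 1 / degThreshold n u ^ 2) (fun v => (v : ℝ) ^ (1 / 9 - 1 : ℝ))
    (fun v _ => by positivity) (c := (n : ℝ) ^ (2 / 3 : ℝ)) (by positivity) (by
      intro u hu T hT hT3
      obtain ⟨a, b, c, hab, hac, hbc, rfl⟩ := card_eq_three.1 hT3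
      have ha := mem_rightNbhd.1 (hT (by simp : a ∈ ({a, b, c} : Finset ℕ)))
      have hb := mem_rightNbhd.1 (hT (by simp : b ∈ ({a, b, c} : Finset ℕ)))
      have hc := mem_rightNbhd.1 (hT (by simp : c ∈ ({a, b, c} : Finset ℕ)))
      rw [prod_insert (by simp [hab, hac]), prod_insert (by simp [hbc]), prod_singleton,
        ← mul_assoc ((a : ℝ) ^ _)]
      exact inv_sq_degThreshold_le hn (mem_Icc.1 hu).1 (hpos _ ha) (hpos _ hb) (hpos _ hc)
        (hmul _ ha) (hmul _ hb) (hmul _ hc) (hle _ ha) (hle _ hb) (hle _ hc))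
  have hsum : ∑ v ∈ Icc 1 (Nat.sqrt n), (v : ℝ) ^ (1 / 9 - 1 : ℝ) ≤
      9 * (n : ℝ) ^ (1 / 18 : ℝ) := by
    have h1 := sum_Icc_rpow_sub_one_le (Nat.sqrt n) (r := 1 / 9) (by norm_num) (by norm_num)
    have h2 : (Nat.sqrt n : ℝ) ^ (1 / 9 : ℝ) ≤ (n : ℝ) ^ (1 / 18 : ℝ) := by
      calc (Nat.sqrt n : ℝ) ^ (1 / 9 : ℝ) ≤ ((n : ℝ) ^ (1 / 2 : ℝ)) ^ (1 / 9 : ℝ) := by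
            gcongr
            rw [← Real.sqrt_eq_rpow]; exact Real.nat_sqrt_le_real_sqrt
        _ = _ := by rw [← Real.rpow_mul hn0.le]; norm_num
    linarith
  have hsum0 : 0 ≤ ∑ v ∈ Icc 1 (Nat.sqrt n), (v : ℝ) ^ (1 / 9 - 1 : ℝ) :=
    sum_nonneg fun v _ => by positivity
  have hcube : 2 * (n : ℝ) ^ (2 / 3 : ℝ) *
      (∑ v ∈ Icc 1 (Nat.sqrt n), (v : ℝ) ^ (1 / 9 - 1 : ℝ)) ^ 3 ≤
      1458 * (n : ℝ) ^ (5 / 6 : ℝ) := by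
    calc _ ≤ 2 * (n : ℝ) ^ (2 / 3 : ℝ) * (9 * (n : ℝ) ^ (1 / 18 : ℝ)) ^ 3 := by gcongr
      _ = 1458 * ((n : ℝ) ^ (2 / 3 : ℝ) * ((n : ℝ) ^ (1 / 18 : ℝ)) ^ 3) := by ring
      _ = _ := by
          rw [← Real.rpow_natCast, ← Real.rpow_mul hn0.le, ← Real.rpow_add hn0]
          norm_num
  calc (E.card : ℝ) = ∑ u ∈ Icc 1 n, ((rightNbhd E u).card : ℝ) := by
        rw [card_eq_sum_card_rightNbhd hU]; push_cast; rfl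
    _ ≤ ∑ u ∈ Icc 1 n, (((min (rightNbhd E u).card 2 : ℕ) : ℝ) + (degThreshold n u +
          6 * ((rightNbhd E u).card.choose 3 : ℝ) / degThreshold n u ^ 2)) :=
        sum_le_sum fun u hu => card_le_add_choose_div _ (degThreshold_pos hn (mem_Icc.1 hu).1)
    _ = (∑ u ∈ Icc 1 n, min (rightNbhd E u).card 2 : ℕ) + (∑ u ∈ Icc 1 n, degThreshold n u +
          6 * ∑ u ∈ Icc 1 n, ((rightNbhd E u).card.choose 3 : ℝ) *
            (1 / degThreshold n u ^ 2)) := by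
        rw [sum_add_distrib, sum_add_distrib, mul_sum]
        push_cast
        congr 2
        exact sum_congr rfl fun u _ => by ring
    _ ≤ _ := by
        have := sum_degThreshold_le hn
        linarith

/-! ### The main term and the upper bound. -/

lemma sum_min_card_le {n : ℕ} (hn : 1 ≤ n) {E : Finset (ℕ × ℕ)}
    (hpos : ∀ e ∈ E, 1 ≤ e.2) (hmul : ∀ e ∈ E, e.1 * e.2 ≤ n)
    (hshape : ∀ e ∈ E, e.1 ^ 3 ≤ n ^ 2 ∨ e.1.Prime) :
    ((∑ u ∈ Icc 1 n, min (rightNbhd E u).card 2 : ℕ) : ℝ) ≤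
      2 * (n : ℝ) ^ (5 / 6 : ℝ) + (Nat.primeCounting n + Nat.primeCounting (n / 2)) := by
  have hn1 : (1 : ℝ) ≤ n := by exact_mod_cast hn
  have hpt : ∀ u ∈ Icc 1 n, min (rightNbhd E u).card 2 ≤ (if u ^ 3 ≤ n ^ 2 then 2 else 0) +
      ((if u.Prime then 1 else 0) + if u.Prime ∧ u ≤ n / 2 then 1 else 0) := by
    intro u hu
    by_cases h : u ^ 3 ≤ n ^ 2
    · rw [if_pos h]; omega
    by_cases hp : u.Prime
    · rw [if_neg h, if_pos hp]
      by_cases hu2 : u ≤ n / 2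
      · rw [if_pos ⟨hp, hu2⟩]; omega
      -- Since `2 * u > n`, the only possible cofactor is `1`.
      · have : (rightNbhd E u).card ≤ 1 := by
          refine (card_le_card (t := {1}) fun v hv => ?_).trans (by simp)
          have h1 := hpos _ (mem_rightNbhd.1 hv)
          have h2 := hmul _ (mem_rightNbhd.1 hv)
          simp only at h1 h2
          rw [mem_singleton]
          by_contra hv1
          have : u * 2 ≤ u * v := Nat.mul_le_mul_left _ (by omega)
          omega
        omega
    · have : rightNbhd E u = ∅ := by
        rw [eq_empty_iff_forall_notMem]
        intro v hv
        exact (hshape _ (mem_rightNbhd.1 hv)).elim h hp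
      rw [this]; simp
  have hcardprime : ∀ m, (Icc 1 m).filter Nat.Prime = (range (m + 1)).filter Nat.Prime := by
    intro m
    ext x
    simp only [mem_filter, mem_Icc, mem_range]
    exact ⟨fun h => ⟨by omega, h.2⟩, fun h => ⟨⟨h.2.one_le, by omega⟩, h.2⟩⟩
  have hpi : ∀ m, ((Icc 1 m).filter Nat.Prime).card = Nat.primeCounting m := by
    intro m
    rw [hcardprime, Nat.primeCounting, Nat.primeCounting', Nat.count_eq_card_filter_range]
  have hsmall : (((Icc 1 n).filter fun u => u ^ 3 ≤ n ^ 2).card : ℝ) ≤ (n : ℝ) ^ (5 / 6 : ℝ) := by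
    have hsub : ((Icc 1 n).filter fun u => u ^ 3 ≤ n ^ 2) ⊆ Icc 1 ⌊(n : ℝ) ^ (2 / 3 : ℝ)⌋₊ := by
      intro u hu
      obtain ⟨h1, h2⟩ := mem_filter.1 hu
      refine mem_Icc.2 ⟨(mem_Icc.1 h1).1, Nat.le_floor ?_⟩
      have h3 : (u : ℝ) ^ (3 : ℕ) ≤ (n : ℝ) ^ (2 : ℕ) := by exact_mod_cast h2
      calc (u : ℝ) = ((u : ℝ) ^ (3 : ℕ)) ^ (1 / 3 : ℝ) := by
            rw [← Real.rpow_natCast, ← Real.rpow_mul (by positivity)]; norm_num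
        _ ≤ ((n : ℝ) ^ (2 : ℕ)) ^ (1 / 3 : ℝ) := by gcongr
        _ = _ := by rw [← Real.rpow_natCast, ← Real.rpow_mul (by positivity)]; norm_num
    calc _ ≤ ((Icc 1 ⌊(n : ℝ) ^ (2 / 3 : ℝ)⌋₊).card : ℝ) := by exact_mod_cast card_le_card hsub
      _ ≤ (n : ℝ) ^ (2 / 3 : ℝ) := by
          rw [Nat.card_Icc, Nat.add_sub_cancel]; exact Nat.floor_le (by positivity)
      _ ≤ _ := Real.rpow_le_rpow_of_exponent_le hn1 (by norm_num)
  have hhalf : ((Icc 1 n).filter fun u => u.Prime ∧ u ≤ n / 2).card = Nat.primeCounting (n / 2) := by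
    rw [← hpi]
    congr 1
    ext x
    simp only [mem_filter, mem_Icc]
    exact ⟨fun h => ⟨⟨h.1.1, h.2.2⟩, h.2.1⟩, fun h => ⟨⟨h.1.1, by omega⟩, h.2, h.1.2⟩⟩
  have htot := sum_le_sum hpt
  rw [sum_add_distrib, sum_add_distrib, ← card_filter, ← card_filter, hpi, hhalf,
    ← sum_filter, sum_const, smul_eq_mul] at htot
  have htot' : ((∑ u ∈ Icc 1 n, min (rightNbhd E u).card 2 : ℕ) : ℝ) ≤
      ((Icc 1 n).filter fun u => u ^ 3 ≤ n ^ 2).card * 2 +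
        (Nat.primeCounting n + Nat.primeCounting (n / 2)) := by exact_mod_cast htot
  linarith

theorem maxSizeF_nine_three_le {n : ℕ} (hn : 1 ≤ n) :
    (maxSizeF 9 3 n : ℝ) - ((Nat.primeCounting n : ℝ) + (Nat.primeCounting (n / 2) : ℝ)) ≤
      8757 * (n : ℝ) ^ (5 / 6 : ℝ) := by
  classical
  obtain ⟨A, hA, hAmax⟩ : ∃ A : Finset ℕ, (A ⊆ Icc 1 n ∧ PropertyP 9 3 (A : Set ℕ)) ∧
      maxSizeF 9 3 n = A.card := by
    have hne : ((Icc 1 n).powerset.filter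
        fun A : Finset ℕ => PropertyP 9 3 (A : Set ℕ)).Nonempty := by
      refine ⟨∅, mem_filter.2 ⟨by simp, ?_⟩⟩
      rintro ⟨a, x, -, ha, -⟩
      -- The empty set qualifies because the index type `Fin 9` is inhabited.
      simpa using ha 0
    obtain ⟨A, hA, h⟩ := exists_mem_eq_sup _ hne Finset.card
    refine ⟨A, ?_, ?_⟩
    · simpa using hA
    · rw [maxSizeF]; convert h
  obtain ⟨hAn, hAP⟩ := hA
  have hrep : ∀ a ∈ A, ∃ e : ℕ × ℕ, e.1 * e.2 = a ∧ e.2 ≤ e.1 ∧ (e.1 ^ 3 ≤ n ^ 2 ∨ e.1.Prime) :=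
    fun a ha => by
      obtain ⟨u, v, h⟩ := cover_by_factor_pair (mem_Icc.1 (hAn ha)).1 (mem_Icc.1 (hAn ha)).2
      exact ⟨(u, v), h⟩
  choose! g hg using hrep
  set E := A.image g with hE
  have hEA : ∀ e ∈ E, e.1 * e.2 ∈ A := fun e he => by
    obtain ⟨a, ha, rfl⟩ := mem_image.1 he
    rw [(hg a ha).1]; exact ha
  have hginv : ∀ e ∈ E, g (e.1 * e.2) = e := fun e he => by
    obtain ⟨a, ha, rfl⟩ := mem_image.1 he
    rw [(hg a ha).1]
  have hcard : E.card = A.card := card_image_of_injOn fun a ha b hb h => by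
    rw [← (hg a ha).1, ← (hg b hb).1, h]
  have hinj : Set.InjOn (fun e : ℕ × ℕ => e.1 * e.2) E := fun e he e' he' h => by
    rw [← hginv e he, ← hginv e' he']
    exact congrArg g h
  have hg' : ∀ e ∈ E, e.2 ≤ e.1 ∧ (e.1 ^ 3 ≤ n ^ 2 ∨ e.1.Prime) := fun e he => by
    obtain ⟨a, ha, rfl⟩ := mem_image.1 he
    exact (hg a ha).2
  have hmul : ∀ e ∈ E, e.1 * e.2 ≤ n := fun e he => (mem_Icc.1 (hAn (hEA e he))).2
  have hpos : ∀ e ∈ E, 1 ≤ e.2 := fun e he =>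
    Nat.pos_of_mul_pos_left (mem_Icc.1 (hAn (hEA e he))).1
  have h1 := card_le_sum_min_add hn (k33Free_of_propertyP hAP hEA hinj) hpos
    (fun e he => (hg' e he).1) hmul
  have h2 := sum_min_card_le hn hpos hmul (fun e he => (hg' e he).2)
  rw [hcard] at h1
  rw [hAmax]
  linarith

/-! ### Chebyshev's estimates. -/

lemma log_factorial_eq_sum (N : ℕ) :
    Real.log (N.factorial : ℝ) =
      ∑ d ∈ Ioc 0 N, ArithmeticFunction.vonMangoldt d * ((N / d : ℕ) : ℝ) := by
  rw [← ArithmeticFunction.sum_Ioc_mul_zeta_eq_sum, ArithmeticFunction.vonMangoldt_mul_zeta]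
  simp only [ArithmeticFunction.log_apply]
  induction N with
  | zero => simp
  | succ N ih =>
    rw [sum_Ioc_succ_top (by omega), ← ih, Nat.factorial_succ, Nat.cast_mul,
      Real.log_mul (by positivity) (by positivity), add_comm]

lemma log_factorial_div_eq_sum (N k : ℕ) :
    Real.log ((N / k).factorial : ℝ) =
      ∑ d ∈ Ioc 0 N, ArithmeticFunction.vonMangoldt d * ((N / d / k : ℕ) : ℝ) := by
  rw [log_factorial_eq_sum]
  refine sum_subset_zero_on_sdiff (Ioc_subset_Ioc_right (Nat.div_le_self N k)) ?_ ?_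
  · intro d hd
    obtain ⟨h1, h2⟩ := mem_sdiff.1 hd
    have h3 : N / k < d := by
      simp only [mem_Ioc] at h1 h2
      omega
    rw [Nat.div_div_eq_div_mul, mul_comm d, ← Nat.div_div_eq_div_mul, Nat.div_eq_of_lt h3]
    simp
  · intro d _
    rw [Nat.div_div_eq_div_mul, Nat.div_div_eq_div_mul, mul_comm d]

lemma le_log_factorial {m : ℕ} (hm : 1 ≤ m) :
    (m : ℝ) * Real.log m - m ≤ Real.log (m.factorial : ℝ) := by
  have h := Stirling.le_log_factorial_stirling (n := m) (by omega)
  have h1 : 0 ≤ Real.log (m : ℝ) := Real.log_natCast_nonneg m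
  have h2 : 0 ≤ Real.log (2 * Real.pi) := Real.log_nonneg (by linarith [Real.pi_gt_three])
  linarith

lemma log_factorial_le {m : ℕ} (hm : 1 ≤ m) :
    Real.log (m.factorial : ℝ) ≤ (m : ℝ) * Real.log m - m + Real.log m + 1 := by
  induction m, hm using Nat.le_induction with
  | base => simp
  | succ m hm ih =>
    have hm0 : (0 : ℝ) < m := by exact_mod_cast hm
    rw [Nat.factorial_succ, Nat.cast_mul, Real.log_mul (by positivity) (by positivity)]
    have h := Real.log_le_sub_one_of_pos (x := (m : ℝ) / (m + 1)) (by positivity)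
    rw [Real.log_div hm0.ne' (by positivity)] at h
    have h2 : (m : ℝ) / (m + 1) - 1 = -(1 / (m + 1)) := by field_simp; ring
    rw [h2] at h
    have h3 : ((m : ℝ) + 1) * (Real.log m - Real.log (m + 1)) ≤ -1 := by
      calc _ ≤ ((m : ℝ) + 1) * -(1 / (m + 1)) := by gcongr
        _ = -1 := by field_simp
    push_cast
    nlinarith

/-- Put `g x = x * log x - x`. Replacing `N / k` by its floor changes `g` by at most `log N`, by the
tangent inequality `log t ≤ t - 1` used in both directions (`a1`, `a2`). -/
lemma abs_log_factorial_div_sub_le {N k : ℕ} (hk : 1 ≤ k) (hkN : k ≤ N) :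
    |Real.log ((N / k).factorial : ℝ) -
      ((N : ℝ) / k * (Real.log N - Real.log k) - (N : ℝ) / k)| ≤ Real.log N + 1 := by
  have hk0 : (0 : ℝ) < k := by exact_mod_cast hk
  have hk1 : (1 : ℝ) ≤ k := by exact_mod_cast hk
  have hN0 : (0 : ℝ) < N := by exact_mod_cast hk.trans hkN
  have hm : 1 ≤ N / k := (Nat.one_le_div_iff hk).2 hkN
  have h1 := le_log_factorial hm
  have h2 := log_factorial_le hm
  have hmx : ((N / k : ℕ) : ℝ) ≤ (N : ℝ) / k := Nat.cast_div_le
  have hxm : (N : ℝ) / k ≤ ((N / k : ℕ) : ℝ) + 1 := by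
    rw [div_le_iff₀ hk0]
    have := Nat.lt_mul_div_succ N hk
    have h' : N ≤ (N / k + 1) * k := by rw [mul_comm]; exact this.le
    exact_mod_cast h'
  have hm1 : (1 : ℝ) ≤ ((N / k : ℕ) : ℝ) := by exact_mod_cast hm
  rw [← Real.log_div hN0.ne' hk0.ne']
  have hxN : Real.log ((N : ℝ) / k) ≤ Real.log N :=
    Real.log_le_log (by positivity) (div_le_self hN0.le hk1)
  generalize ((N / k : ℕ) : ℝ) = m at *
  generalize Real.log ((N / k).factorial : ℝ) = F at *
  set x := (N : ℝ) / k
  have hm0 : 0 < m := by linarith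
  have hx0 : 0 < x := by linarith
  have hlm : 0 ≤ Real.log m := Real.log_nonneg hm1
  have hlx : 0 ≤ Real.log x := Real.log_nonneg (by linarith)
  have hmono : Real.log m ≤ Real.log x := Real.log_le_log hm0 hmx
  have a1 : m * (Real.log x - Real.log m) ≤ x - m := by
    rw [← Real.log_div hx0.ne' hm0.ne']
    calc _ ≤ m * (x / m - 1) := by
          gcongr; exact Real.log_le_sub_one_of_pos (by positivity)
      _ = _ := by field_simp
  have a2 : x * (Real.log m - Real.log x) ≤ m - x := by
    rw [← Real.log_div hm0.ne' hx0.ne']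
    calc _ ≤ x * (m / x - 1) := by
          gcongr; exact Real.log_le_sub_one_of_pos (by positivity)
      _ = _ := by field_simp
  rw [abs_le]
  constructor
  · nlinarith
  · nlinarith

/-- The constant in Chebyshev's estimates for the primes. -/
noncomputable def chebyshevConst : ℝ :=
  Real.log 2 / 2 + Real.log 3 / 3 + Real.log 5 / 5 - Real.log 30 / 30

lemma chebyshevConst_bounds : 0.92 ≤ chebyshevConst ∧ chebyshevConst ≤ 0.925 := by
  have h30 : Real.log 30 = Real.log 2 + Real.log 3 + Real.log 5 := by
    rw [← Real.log_mul (by norm_num) (by norm_num), ← Real.log_mul (by norm_num) (by norm_num)]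
    norm_num
  have pow_le : ∀ (a b : ℝ) (i j : ℕ), 0 < a → a ^ i ≤ b ^ j →
      i * Real.log a ≤ j * Real.log b := by
    intro a b i j ha h
    rw [← Real.log_pow, ← Real.log_pow]
    exact Real.log_le_log (by positivity) h
  -- Rational bounds for `log 3 / log 2` and `log 5 / log 2`, after which only `log 2` needs
  -- decimals.
  have a1 := pow_le 2 3 19 12 (by norm_num) (by norm_num)
  have a2 := pow_le 3 2 17 27 (by norm_num) (by norm_num)
  have a3 := pow_le 2 5 65 28 (by norm_num) (by norm_num)
  have a4 := pow_le 5 2 3 7 (by norm_num) (by norm_num)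
  have := Real.log_two_gt_d9
  have := Real.log_two_lt_d9
  push_cast at a1 a2 a3 a4
  rw [chebyshevConst, h30]
  constructor <;> linarith

/-- Chebyshev's combination of factorials. -/
noncomputable def chebyshevSum (N : ℕ) : ℝ :=
  Real.log (N.factorial : ℝ) - Real.log ((N / 2).factorial : ℝ)
    - Real.log ((N / 3).factorial : ℝ) - Real.log ((N / 5).factorial : ℝ)
    + Real.log ((N / 30).factorial : ℝ)

/-- Since `1 - 1/2 - 1/3 - 1/5 + 1/30 = 0`, the terms `N * log N` and `N` cancel; only the `log k /
k` survive. -/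
lemma abs_chebyshevSum_sub_le {N : ℕ} (hN : 30 ≤ N) :
    |chebyshevSum N - chebyshevConst * N| ≤ 5 * (Real.log N + 1) := by
  have h1 := abs_le.1 (abs_log_factorial_div_sub_le (N := N) (k := 1) (by omega) (by omega))
  have h2 := abs_le.1 (abs_log_factorial_div_sub_le (N := N) (k := 2) (by omega) (by omega))
  have h3 := abs_le.1 (abs_log_factorial_div_sub_le (N := N) (k := 3) (by omega) (by omega))
  have h5 := abs_le.1 (abs_log_factorial_div_sub_le (N := N) (k := 5) (by omega) (by omega))
  have h30 := abs_le.1 (abs_log_factorial_div_sub_le (N := N) (k := 30) (by omega) (by omega))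
  rw [Nat.div_one] at h1
  push_cast at h1 h2 h3 h5 h30
  rw [Real.log_one] at h1
  rw [abs_le, chebyshevSum, chebyshevConst]
  constructor <;> linarith

lemma chebyshevSum_eq (N : ℕ) :
    chebyshevSum N = ∑ d ∈ Ioc 0 N, ArithmeticFunction.vonMangoldt d *
      (((N / d : ℕ) : ℝ) - (N / d / 2 : ℕ) - (N / d / 3 : ℕ) - (N / d / 5 : ℕ)
        + (N / d / 30 : ℕ)) := by
  rw [chebyshevSum, log_factorial_eq_sum, log_factorial_div_eq_sum N 2,
    log_factorial_div_eq_sum N 3,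
    log_factorial_div_eq_sum N 5,
    log_factorial_div_eq_sum N 30,
    ← sum_sub_distrib, ← sum_sub_distrib, ← sum_sub_distrib, ← sum_add_distrib]
  exact sum_congr rfl fun d _ => by ring

lemma chebyshevSum_le_psi (N : ℕ) : chebyshevSum N ≤ Chebyshev.psi N := by
  rw [chebyshevSum_eq, Chebyshev.psi, Nat.floor_natCast]
  refine sum_le_sum fun d _ => ?_
  have h : (((N / d : ℕ) : ℝ) - (N / d / 2 : ℕ) - (N / d / 3 : ℕ) - (N / d / 5 : ℕ)
        + (N / d / 30 : ℕ)) ≤ 1 := by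
    generalize N / d = m
    have : m + m / 30 ≤ 1 + m / 2 + m / 3 + m / 5 := by omega
    have : ((m + m / 30 : ℕ) : ℝ) ≤ ((1 + m / 2 + m / 3 + m / 5 : ℕ) : ℝ) := by
      exact_mod_cast this
    push_cast at this
    linarith
  calc _ ≤ ArithmeticFunction.vonMangoldt d * 1 := by
        gcongr
    _ = _ := mul_one _

/-- The coefficient `m - m/2 - m/3 - m/5 + m/30` (with floors) is never negative and is at least 1
for `1 ≤ m ≤ 5`, that is, for `N / 6 < d ≤ N`. -/
lemma psi_sub_psi_div_six_le (N : ℕ) :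
    Chebyshev.psi N - Chebyshev.psi (N / 6 : ℕ) ≤ chebyshevSum N := by
  have hs : Ioc 0 N = Ioc 0 (N / 6) ∪ Ioc (N / 6) N := by
    ext x; simp only [mem_union, mem_Ioc]; omega
  have hd : Disjoint (Ioc 0 (N / 6)) (Ioc (N / 6) N) := by
    rw [disjoint_left]; intro x; simp only [mem_Ioc]; omega
  rw [chebyshevSum_eq, Chebyshev.psi, Chebyshev.psi, Nat.floor_natCast, Nat.floor_natCast, hs,
    sum_union hd, sum_union hd, add_sub_cancel_left]
  have h1 : 0 ≤ ∑ d ∈ Ioc 0 (N / 6), ArithmeticFunction.vonMangoldt d *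
      (((N / d : ℕ) : ℝ) - (N / d / 2 : ℕ) - (N / d / 3 : ℕ) - (N / d / 5 : ℕ)
        + (N / d / 30 : ℕ)) := by
    refine sum_nonneg fun d _ => mul_nonneg ArithmeticFunction.vonMangoldt_nonneg ?_
    generalize N / d = m
    have : m / 2 + m / 3 + m / 5 ≤ m + m / 30 := by omega
    have : ((m / 2 + m / 3 + m / 5 : ℕ) : ℝ) ≤ ((m + m / 30 : ℕ) : ℝ) := by exact_mod_cast this
    push_cast at this
    linarith
  have h2 : ∑ d ∈ Ioc (N / 6) N, ArithmeticFunction.vonMangoldt d ≤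
      ∑ d ∈ Ioc (N / 6) N, ArithmeticFunction.vonMangoldt d *
      (((N / d : ℕ) : ℝ) - (N / d / 2 : ℕ) - (N / d / 3 : ℕ) - (N / d / 5 : ℕ)
        + (N / d / 30 : ℕ)) := by
    refine sum_le_sum fun d hd => ?_
    obtain ⟨hd1, hd2⟩ := mem_Ioc.1 hd
    have hd0 : 0 < d := by omega
    have h6 : N / d < 6 := by
      rw [Nat.div_lt_iff_lt_mul hd0]; omega
    have h1 : 1 ≤ N / d := (Nat.one_le_div_iff hd0).2 hd2
    generalize N / d = m at *
    have : 1 + m / 2 + m / 3 + m / 5 ≤ m + m / 30 := by omega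
    have : ((1 + m / 2 + m / 3 + m / 5 : ℕ) : ℝ) ≤ ((m + m / 30 : ℕ) : ℝ) := by
      exact_mod_cast this
    push_cast at this
    calc _ = ArithmeticFunction.vonMangoldt d * 1 := (mul_one _).symm
      _ ≤ _ := by
        gcongr
        linarith
  linarith

open Filter in
lemma eventually_log_add_one_le {ε : ℝ} (hε : 0 < ε) :
    ∀ᶠ N : ℕ in atTop, Real.log N + 1 ≤ ε * N := by
  have h1 : ∀ᶠ x : ℝ in atTop, Real.log x ≤ ε / 2 * x := by
    filter_upwards [Real.isLittleO_log_id_atTop.bound (half_pos hε), eventually_ge_atTop 1]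
      with x hx hx1
    rw [Real.norm_eq_abs, id, Real.norm_eq_abs, abs_of_nonneg (by linarith : 0 ≤ x)] at hx
    exact (le_abs_self _).trans hx
  have h2 : ∀ᶠ x : ℝ in atTop, 1 ≤ ε / 2 * x :=
    (tendsto_id.const_mul_atTop (half_pos hε)).eventually_ge_atTop 1
  filter_upwards [tendsto_natCast_atTop_atTop.eventually h1,
    tendsto_natCast_atTop_atTop.eventually h2] with N a b
  linarith

open Filter in
theorem eventually_theta_bounds :
    ∀ᶠ N : ℕ in atTop, 0.915 * N ≤ Chebyshev.theta N ∧ Chebyshev.theta N ≤ 1.12 * N := by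
  obtain ⟨hA1, hA2⟩ := chebyshevConst_bounds
  obtain ⟨C, hC⟩ := Chebyshev.psi_sub_theta_le_mul_sqrt
  have hC0 : ∀ᶠ N : ℕ in atTop, C * Real.sqrt N ≤ 0.001 * N := by
    have : Tendsto (fun N : ℕ => Real.sqrt N) atTop atTop :=
      Real.tendsto_sqrt_atTop.comp tendsto_natCast_atTop_atTop
    filter_upwards [this.eventually_ge_atTop (1000 * C)] with N hN
    have h := Real.sq_sqrt (Nat.cast_nonneg (α := ℝ) N)
    have h' := Real.sqrt_nonneg (N : ℝ)
    nlinarith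
  obtain ⟨N₁, hN₁⟩ := eventually_atTop.1 (eventually_log_add_one_le (ε := 0.0005) (by norm_num))
  -- Iterating `N ↦ N / 6` costs a factor `6/5`: `0.925 + 5 * 0.0005 + 1.115 / 6 < 1.115`. The `N`
  -- below the threshold go into the additive constant.
  have hup : ∀ N : ℕ, Chebyshev.psi N ≤ 1.115 * N + Chebyshev.psi ((max N₁ 30 : ℕ) : ℝ) := by
    intro N
    induction N using Nat.strong_induction_on with
    | _ N ih =>
      by_cases hN : N ≤ max N₁ 30
      · have := Chebyshev.psi_mono (show (N : ℝ) ≤ (max N₁ 30 : ℕ) by exact_mod_cast hN)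
        have h0 : (0 : ℝ) ≤ N := Nat.cast_nonneg N
        linarith
      · have hN1 : N₁ ≤ N := by omega
        have hN30 : 30 ≤ N := by omega
        have h1 := psi_sub_psi_div_six_le N
        have h2 := (abs_le.1 (abs_chebyshevSum_sub_le hN30)).2
        have h3 := ih (N / 6) (by omega)
        have h4 := hN₁ N hN1
        have h5 : ((N / 6 : ℕ) : ℝ) ≤ (N : ℝ) / 6 := by
          simpa using (Nat.cast_div_le (α := ℝ) (m := N) (n := 6))
        have h6 : (0 : ℝ) ≤ N := Nat.cast_nonneg N
        nlinarith
  have hconst : ∀ᶠ N : ℕ in atTop, Chebyshev.psi ((max N₁ 30 : ℕ) : ℝ) ≤ 0.005 * (N : ℝ) :=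
    (tendsto_natCast_atTop_atTop.const_mul_atTop (by norm_num)).eventually_ge_atTop _
  filter_upwards [hC0, eventually_ge_atTop N₁, eventually_ge_atTop 30, hconst]
    with N h1 h2 h3 h4
  have h5 := hC N
  have h6 := chebyshevSum_le_psi N
  have h7 := (abs_le.1 (abs_chebyshevSum_sub_le h3)).1
  have h8 := hN₁ N h2
  have h9 := Chebyshev.theta_le_psi N
  have h10 := hup N
  have h11 : (0 : ℝ) ≤ N := Nat.cast_nonneg N
  constructor <;> nlinarith

/-! ### Projective norm graphs. -/

lemma leadingCoeff_eq_zero_of_three_roots {K : Type*} [Field K] {α β γ x y z : K} (hxy : x ≠ y)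
    (hxz : x ≠ z) (hyz : y ≠ z) (hx : α * x ^ 2 + β * x + γ = 0)
    (hy : α * y ^ 2 + β * y + γ = 0) (hz : α * z ^ 2 + β * z + γ = 0) : α = 0 := by
  have h1 : α * (x + y) + β = 0 := by
    refine (mul_eq_zero.1 ?_).resolve_left (sub_ne_zero.2 hxy)
    linear_combination hx - hy
  have h2 : α * (x + z) + β = 0 := by
    refine (mul_eq_zero.1 ?_).resolve_left (sub_ne_zero.2 hxz)
    linear_combination hx - hz
  refine (mul_eq_zero.1 ?_).resolve_right (sub_ne_zero.2 hyz)
  linear_combination h1 - h2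

/-- Two norm equations `N (y + c₁) = d₁`, `N (y + c₂) = d₂` have at most two common solutions. -/
lemma not_three_common_norm_solutions {K : Type*} [Field K] (σ : K →+* K) {c₁ c₂ d₁ d₂ : K}
    (hc : c₁ ≠ c₂) (y : Fin 3 → K) (hy : Function.Injective y)
    (h₁ : ∀ j, (y j + c₁) * σ (y j + c₁) = d₁) (h₂ : ∀ j, (y j + c₂) * σ (y j + c₂) = d₂) :
    False := by
  -- The difference of the two equations is linear in `y` and `σ y`; eliminating `σ y` leaves a
  -- quadratic in `y` with leading coefficient `-σ (c₁ - c₂) ≠ 0`.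
  have hquad : ∀ j, (-(σ c₁ - σ c₂)) * y j ^ 2 +
      ((d₁ - d₂ - (c₁ * σ c₁ - c₂ * σ c₂)) + σ c₁ * (c₁ - c₂) - c₁ * (σ c₁ - σ c₂)) * y j +
      (c₁ * ((d₁ - d₂ - (c₁ * σ c₁ - c₂ * σ c₂)) + σ c₁ * (c₁ - c₂)) - d₁ * (c₁ - c₂)) = 0 := by
    intro j
    have e₁ := h₁ j
    have e₂ := h₂ j
    rw [map_add] at e₁ e₂
    linear_combination (c₁ - c₂) * e₁ - (y j + c₁) * (e₁ - e₂)
  have := leadingCoeff_eq_zero_of_three_roots (hy.ne (by decide : (0 : Fin 3) ≠ 1))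
    (hy.ne (by decide : (0 : Fin 3) ≠ 2)) (hy.ne (by decide : (1 : Fin 3) ≠ 2))
    (hquad 0) (hquad 1) (hquad 2)
  rw [neg_eq_zero, sub_eq_zero] at this
  exact hc (σ.injective this)

/-- The projective norm graph contains no `K_{3,3}`. -/
lemma projectiveNormGraph_k33Free {K : Type*} [Field K] (σ : K →+* K) (A B : Fin 3 → K)
    (a b : Fin 3 → K) (ha : ∀ i, a i ≠ 0) (hb : ∀ i, b i ≠ 0)
    (hA : Function.Injective fun i => (A i, a i)) (hB : Function.Injective fun i => (B i, b i))
    (h : ∀ i j, (A i + B j) * σ (A i + B j) = a i * b j) : False := by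
  have hAinj : Function.Injective A := by
    intro i j hij
    apply hA
    have h1 := h i 0
    rw [hij, h j 0] at h1
    exact Prod.ext hij (mul_right_cancel₀ (hb 0) h1).symm
  have hBinj : Function.Injective B := by
    intro i j hij
    apply hB
    have h1 := h 0 i
    rw [hij, h 0 j] at h1
    exact Prod.ext hij (mul_left_cancel₀ (ha 0) h1).symm
  have hne : ∀ i j, A i + B j ≠ 0 := by
    intro i j h0
    have := h i j
    rw [h0, zero_mul] at this
    exact mul_ne_zero (ha i) (hb j) this.symm
  have hB0 : B 0 - B 2 ≠ 0 := sub_ne_zero.2 (hBinj.ne (by decide))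
  have hB1 : B 1 - B 2 ≠ 0 := sub_ne_zero.2 (hBinj.ne (by decide))
  -- Dividing the equation for `j` by the one for `2` eliminates `a i`; in the unknown `(A i + B
  -- 2)⁻¹` it becomes a norm equation. The cases `j = 0, 1` then have three common solutions.
  have key : ∀ j, B j - B 2 ≠ 0 → ∀ i, ((A i + B 2)⁻¹ + (B j - B 2)⁻¹) *
      σ ((A i + B 2)⁻¹ + (B j - B 2)⁻¹) = b j / (b 2 * ((B j - B 2) * σ (B j - B 2))) := by
    intro j hj i
    have e : (A i + B 2)⁻¹ + (B j - B 2)⁻¹ = (A i + B j) / ((A i + B 2) * (B j - B 2)) := by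
      have := hne i 2
      field_simp
      ring
    have hs : σ (B j - B 2) ≠ 0 := (map_ne_zero σ).2 hj
    have hs2 : σ (A i + B 2) ≠ 0 := (map_ne_zero σ).2 (hne i 2)
    calc _ = ((A i + B j) * σ (A i + B j)) / (((A i + B 2) * σ (A i + B 2)) *
          ((B j - B 2) * σ (B j - B 2))) := by
          rw [e, map_div₀, map_mul, div_mul_div_comm]
          congr 1
          ring
      _ = _ := by
          rw [h i j, h i 2]
          have := ha i
          have := hb 2
          field_simp
  refine not_three_common_norm_solutions σ (c₁ := (B 0 - B 2)⁻¹) (c₂ := (B 1 - B 2)⁻¹) ?_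
    (fun i => (A i + B 2)⁻¹) ?_ (key 0 hB0) (key 1 hB1)
  · intro h0
    exact absurd (hBinj (sub_left_injective (inv_injective h0))) (by decide)
  · intro i j hij
    exact hAinj (add_left_injective _ (inv_injective hij))

/-- Averaging: some `k`-subset carries at least its proportional share of a weight. -/
lemma exists_subset_card_mul_sum_le {α : Type*} [DecidableEq α] (s : Finset α) (f : α → ℕ) (k : ℕ)
    (hk : k ≤ s.card) :
    ∃ t ⊆ s, t.card = k ∧ k * ∑ x ∈ s, f x ≤ s.card * ∑ x ∈ t, f x := by
  induction hn : s.card - k generalizing s with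
  | zero => exact ⟨s, Subset.rfl, by omega, by rw [show k = s.card by omega]⟩
  | succ m ih =>
    have hs : s.Nonempty := card_pos.1 (by omega)
    obtain ⟨x, hx, hmin⟩ := exists_min_image s f hs
    have hc := card_erase_of_mem hx
    obtain ⟨t, ht, htk, hle⟩ := ih (s.erase x) (by omega) (by omega)
    refine ⟨t, ht.trans (erase_subset _ _), htk, ?_⟩
    have hsum := add_sum_erase s f hx
    have hlow : k * f x ≤ ∑ y ∈ t, f y := by
      rw [← htk, ← smul_eq_mul, ← sum_const]
      exact sum_le_sum fun y hy => hmin y (mem_of_mem_erase (ht hy))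
    have hcard : s.card = (s.erase x).card + 1 := by omega
    rw [← hsum, hcard]
    nlinarith

/-- Dense bipartite graphs without `K_{3,3}`, from projective norm graphs. -/
theorem exists_k33Free_subset {α β : Type*} {q : ℕ} (hq : q.Prime) (B : Finset α)
    (S : Finset β) (hB : B.card ≤ q ^ 2 * (q - 1)) (hS : S.card ≤ q ^ 2 * (q - 1)) :
    ∃ E ⊆ B ×ˢ S, K33Free E ∧ B.card * S.card ≤ E.card * q := by
  classical
  have : Fact q.Prime := ⟨hq⟩
  let K := GaloisField q 2
  have : Fintype K := Fintype.ofFinite K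
  let N : K → ZMod q := Algebra.norm (ZMod q)
  have hNσ : ∀ x : K, algebraMap (ZMod q) K (N x) = x * frobenius K q x := by
    intro x
    have := FiniteField.algebraMap_norm_eq_pow_sum (ZMod q) K x
    rw [GaloisField.finrank q (by norm_num)] at this
    simpa [Finset.sum_range_succ, pow_add, frobenius_def] using this
  let V := K × (ZMod q)ˣ
  have hcardK : Fintype.card K = q ^ 2 := by
    rw [← Nat.card_eq_fintype_card]; exact GaloisField.card q 2 (by norm_num)
  have hcardV : (univ : Finset V).card = q ^ 2 * (q - 1) := by
    rw [card_univ, Fintype.card_prod, hcardK, ZMod.card_units_eq_totient, Nat.totient_prime hq]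
  let adj : V → V → Prop := fun x y => N (x.1 + y.1) = x.2 * y.2
  -- For each `z ≠ -x.1` exactly one second coordinate makes `(z, _)` adjacent to `x`; the value `1`
  -- in `φ` is a default for the excluded `z`.
  have hdeg : ∀ x : V, q ^ 2 - 1 ≤ (univ.filter fun y => adj x y).card := by
    intro x
    have hN0 : ∀ z : K, z ≠ 0 → N z ≠ 0 := fun z hz h => hz (Algebra.norm_eq_zero_iff.1 h)
    have hcard : ((univ : Finset K).erase (-x.1)).card = q ^ 2 - 1 := by
      rw [card_erase_of_mem (mem_univ _), card_univ, hcardK]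
    rw [← hcard]
    let φ : K → V := fun z =>
      if h : N (x.1 + z) = 0 then (z, 1) else (z, x.2⁻¹ * Units.mk0 (N (x.1 + z)) h)
    have hφ : ∀ z, (φ z).1 = z := fun z => by
      simp only [φ]; split_ifs <;> rfl
    refine card_le_card_of_injOn φ ?_ ?_
    · intro z hz
      have hz' : x.1 + z ≠ 0 := fun h => (mem_erase.1 hz).1 (eq_neg_of_add_eq_zero_right h)
      refine mem_coe.2 (mem_filter.2 ⟨mem_univ _, ?_⟩)
      change N (x.1 + (φ z).1) = x.2 * (φ z).2
      rw [hφ]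
      simp only [φ, dif_neg (hN0 _ hz'), Units.val_mul, Units.val_mk0, Units.mul_inv_cancel_left]
    · intro z _ z' _ h
      rw [← hφ z, ← hφ z', h]
  obtain ⟨F, -, hF⟩ := B.finite_toSet.exists_injOn_of_encard_le (t := ((univ : Finset V) : Set V)) (by
    rw [Set.encard_coe_eq_coe_finsetCard, Set.encard_coe_eq_coe_finsetCard, hcardV]
    exact_mod_cast hB)
  -- `B` is placed among the vertices arbitrarily, but `S` goes to a set of above-average total
  -- degree into `B`, so no edge density is lost.
  obtain ⟨W, -, hWS, hW⟩ := exists_subset_card_mul_sum_le (univ : Finset V)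
    (fun y => (B.filter fun x => adj (F x) y).card) S.card (by rw [hcardV]; exact hS)
  obtain ⟨G, hGW, hG⟩ := S.finite_toSet.exists_injOn_of_encard_le (t := (W : Set V)) (by
    rw [Set.encard_coe_eq_coe_finsetCard, Set.encard_coe_eq_coe_finsetCard, hWS])
  have himage : S.image G = W :=
    eq_of_subset_of_card_le (image_subset_iff.2 fun x hx => hGW hx)
      (by rw [card_image_of_injOn hG, hWS])
  let E := (B ×ˢ S).filter fun e => adj (F e.1) (G e.2)
  have hEcard : E.card = ∑ y ∈ W, (B.filter fun x => adj (F x) y).card := by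
    rw [← himage, sum_image hG, card_filter, sum_product_right]
    exact sum_congr rfl fun y _ => (card_filter _ _).symm
  have htotal : B.card * (q ^ 2 - 1) ≤
      ∑ y : V, (B.filter fun x => adj (F x) y).card := by
    simp_rw [card_filter]
    rw [sum_comm, ← smul_eq_mul, ← sum_const]
    exact sum_le_sum fun x _ => (hdeg (F x)).trans_eq (card_filter _ _)
  refine ⟨E, filter_subset _ _, ?_, ?_⟩
  · intro L R hL hR hLR
    obtain ⟨l, hl⟩ : ∃ l : Fin 3 → α, Function.Injective l ∧ ∀ i, l i ∈ L :=
      ⟨fun i => (L.equivFinOfCardEq hL).symm i,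
        Subtype.val_injective.comp (Equiv.injective _), fun i => Subtype.prop _⟩
    obtain ⟨r, hr⟩ : ∃ r : Fin 3 → β, Function.Injective r ∧ ∀ i, r i ∈ R :=
      ⟨fun i => (R.equivFinOfCardEq hR).symm i,
        Subtype.val_injective.comp (Equiv.injective _), fun i => Subtype.prop _⟩
    have hmem : ∀ i j, (l i ∈ B ∧ r j ∈ S) ∧ adj (F (l i)) (G (r j)) := fun i j => by
      have := mem_filter.1 (hLR (mk_mem_product (hl.2 i) (hr.2 j)))
      exact ⟨mem_product.1 this.1, this.2⟩
    have hunit : Function.Injective fun u : (ZMod q)ˣ => algebraMap (ZMod q) K u :=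
      (algebraMap (ZMod q) K).injective.comp Units.val_injective
    refine projectiveNormGraph_k33Free (frobenius K q) (fun i => (F (l i)).1)
      (fun j => (G (r j)).1) (fun i => algebraMap (ZMod q) K (F (l i)).2)
      (fun j => algebraMap (ZMod q) K (G (r j)).2) (fun i => ?_) (fun j => ?_) ?_ ?_ ?_
    · simp
    · simp
    · intro i j hij
      obtain ⟨h1, h2⟩ := Prod.mk.inj hij
      exact hl.1 (hF (hmem i 0).1.1 (hmem j 0).1.1 (Prod.ext h1 (hunit h2)))
    · intro i j hij
      obtain ⟨h1, h2⟩ := Prod.mk.inj hij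
      exact hr.1 (hG (hmem 0 i).1.2 (hmem 0 j).1.2 (Prod.ext h1 (hunit h2)))
    · intro i j
      rw [← hNσ, (hmem i j).2, map_mul]
  · rw [← hEcard, hcardV] at hW
    have h1 : S.card * (B.card * (q ^ 2 - 1)) ≤ q ^ 2 * (q - 1) * E.card :=
      (Nat.mul_le_mul_left _ htotal).trans hW
    -- There are `q ^ 2 * (q - 1)` vertices of degree at least `(q - 1) * (q + 1)`; cancelling `q -
    -- 1` leaves density at least `(q + 1) / q ^ 2 ≥ 1 / q`.
    obtain ⟨m, rfl⟩ : ∃ m, q = m + 2 := Nat.exists_eq_add_of_le' hq.two_le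
    have e1 : (m + 2) ^ 2 - 1 = (m + 1) * (m + 3) := by
      rw [show (m + 2) ^ 2 = (m + 1) * (m + 3) + 1 by ring, Nat.add_sub_cancel]
    rw [e1, show m + 2 - 1 = m + 1 by omega] at h1
    have h2 : (m + 1) * (B.card * S.card * (m + 2)) ≤ (m + 1) * (E.card * (m + 2) * (m + 2)) := by
      calc (m + 1) * (B.card * S.card * (m + 2)) ≤ S.card * (B.card * ((m + 1) * (m + 3))) := by
            nlinarith [Nat.zero_le ((m + 1) * (B.card * S.card))]
        _ ≤ _ := h1
        _ = _ := by ring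
    exact Nat.le_of_mul_le_mul_right (Nat.le_of_mul_le_mul_left h2 (by omega)) (by omega)

/-! ### The set attaining the lower bound. -/

/-- Occurring vertices have degree at least 3, so nine edges meet at most three vertices on each
side and must fill the whole `3 × 3` grid. -/
lemma exists_k33_of_three_dvd_degrees {α β : Type*} [DecidableEq α] [DecidableEq β]
    {T : Finset (α × β)} (hT : T.card = 9) (h₁ : ∀ e ∈ T, 3 ∣ (T.filter fun f => f.1 = e.1).card)
    (h₂ : ∀ e ∈ T, 3 ∣ (T.filter fun f => f.2 = e.2).card) :
    ∃ (L : Finset α) (R : Finset β), L.card = 3 ∧ R.card = 3 ∧ L ×ˢ R ⊆ T := by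
  have hL : 3 * (T.image Prod.fst).card ≤ 9 := by
    rw [← hT]
    refine mul_card_image_le_card T 3 fun a ha => ?_
    obtain ⟨e, he, rfl⟩ := mem_image.1 ha
    exact Nat.le_of_dvd (card_pos.2 ⟨e, mem_filter.2 ⟨he, rfl⟩⟩) (h₁ e he)
  have hR : 3 * (T.image Prod.snd).card ≤ 9 := by
    rw [← hT]
    refine mul_card_image_le_card T 3 fun a ha => ?_
    obtain ⟨e, he, rfl⟩ := mem_image.1 ha
    exact Nat.le_of_dvd (card_pos.2 ⟨e, mem_filter.2 ⟨he, rfl⟩⟩) (h₂ e he)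
  have hsub : T ⊆ T.image Prod.fst ×ˢ T.image Prod.snd := fun e he =>
    mem_product.2 ⟨mem_image_of_mem _ he, mem_image_of_mem _ he⟩
  have hle := card_le_card hsub
  rw [card_product, hT] at hle
  have hL3 : (T.image Prod.fst).card = 3 := by nlinarith
  have hR3 : (T.image Prod.snd).card = 3 := by nlinarith
  refine ⟨_, _, hL3, hR3, (eq_of_subset_of_card_le hsub ?_).symm.subset⟩
  rw [card_product, hL3, hR3, hT]

lemma three_dvd_sum_factorization {a : Fin 9 → ℕ} {x : ℤ} (hpos : ∀ i, a i ≠ 0)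
    (hinj : Function.Injective a) (h : ∏ i, (a i : ℤ) = x ^ 3) (r : ℕ) :
    3 ∣ ∑ t ∈ univ.image a, t.factorization r := by
  have h' : ∏ i, a i = x.natAbs ^ 3 := by
    have := congrArg Int.natAbs h
    rw [Int.natAbs_pow] at this
    rw [← this, ← Nat.cast_prod, Int.natAbs_natCast]
  rw [sum_image fun i _ j _ hij => hinj hij]
  have h2 := congrArg (fun m => m.factorization r) h'
  simp only [Nat.factorization_pow] at h2
  rw [Nat.factorization_prod fun i _ => hpos i, Finsupp.finsetSum_apply] at h2
  rw [h2]
  simp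

lemma factorization_mul_primes {p q : ℕ} (hp : p.Prime) (hq : q.Prime) (r : ℕ) :
    (p * q).factorization r = (if p = r then 1 else 0) + if q = r then 1 else 0 := by
  rw [Nat.factorization_mul hp.ne_zero hq.ne_zero, Finsupp.add_apply, hp.factorization,
    hq.factorization, Finsupp.single_apply, Finsupp.single_apply]

lemma injOn_mul_of_primes {B S : Finset ℕ} (hB : ∀ p ∈ B, p.Prime) (hS : ∀ p ∈ S, p.Prime)
    (hBS : Disjoint B S) :
    Set.InjOn (fun e : ℕ × ℕ => e.1 * e.2) (B ×ˢ S : Finset (ℕ × ℕ)) := by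
  intro e he f hf h
  obtain ⟨he1, he2⟩ := mem_product.1 he
  obtain ⟨hf1, hf2⟩ := mem_product.1 hf
  have h1 : e.1 = f.1 := by
    have hd : e.1 ∣ f.1 * f.2 := Dvd.intro _ h
    rcases (hB _ he1).dvd_mul.1 hd with hd | hd
    · exact (Nat.prime_dvd_prime_iff_eq (hB _ he1) (hB _ hf1)).1 hd
    · have h2 := (Nat.prime_dvd_prime_iff_eq (hB _ he1) (hS _ hf2)).1 hd
      exact (disjoint_left.1 hBS he1 (h2 ▸ hf2)).elim
  refine Prod.ext h1 ?_
  simp only [h1] at h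
  exact Nat.eq_of_mul_eq_mul_left (hB _ hf1).pos h

lemma propertyP_nine_three {y : ℕ} (hy : 2 ≤ y) {P Q B S : Finset ℕ} {E : Finset (ℕ × ℕ)}
    (hP : ∀ p ∈ P, p.Prime ∧ y < p) (hQ : ∀ p ∈ Q, p.Prime ∧ y < p)
    (hB : ∀ p ∈ B, p.Prime ∧ p ≤ y) (hS : ∀ p ∈ S, p.Prime ∧ p ≤ y) (hBS : Disjoint B S)
    (hE : E ⊆ B ×ˢ S) (hfree : K33Free E) :
    PropertyP 9 3 ((P ∪ Q.image (2 * ·) ∪ E.image fun e => e.1 * e.2 : Finset ℕ) : Set ℕ) := by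
  rintro ⟨a, x, ha, hmem, hx⟩
  have hEB : ∀ e ∈ E, (e.1.Prime ∧ e.1 ≤ y) ∧ (e.2.Prime ∧ e.2 ≤ y) := fun e he =>
    ⟨hB _ (mem_product.1 (hE he)).1, hS _ (mem_product.1 (hE he)).2⟩
  have hcases : ∀ t ∈ univ.image a, (t.Prime ∧ y < t) ∨ (∃ p, p.Prime ∧ y < p ∧ t = p * 2) ∨
      ∃ e ∈ E, t = e.1 * e.2 := by
    intro t ht
    obtain ⟨i, -, rfl⟩ := mem_image.1 ht
    have := hmem i
    simp only [coe_union, Set.mem_union, mem_coe, mem_image] at this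
    rcases this with (h | ⟨p, h, h'⟩) | ⟨e, h, h'⟩
    · exact Or.inl (hP _ h)
    · exact Or.inr (Or.inl ⟨p, (hQ _ h).1, (hQ _ h).2, by rw [← h', mul_comm]⟩)
    · exact Or.inr (Or.inr ⟨e, h, h'.symm⟩)
  have hne : ∀ i, a i ≠ 0 := fun i => by
    rcases hcases (a i) (mem_image_of_mem _ (mem_univ i)) with h | ⟨p, hp, -, h⟩ | ⟨e, he, h⟩
    · exact h.1.ne_zero
    · rw [h]; exact mul_ne_zero hp.ne_zero two_ne_zero
    · rw [h]; exact mul_ne_zero (hEB e he).1.1.ne_zero (hEB e he).2.1.ne_zero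
  have hdvd := three_dvd_sum_factorization hne ha.injective hx
  have hcard : (univ.image a).card = 9 := by
    rw [card_image_of_injective _ ha.injective]; simp
  set T := univ.image a with hTdef
  have hlarge : ∀ r, r.Prime → y < r → ∀ t ∈ T, t.factorization r ≠ 0 → False := by
    intro r hr hyr t ht htr
    -- Only `r` and `2 * r` are multiples of `r` in the set, each to the first power (`2 ≠ r` since
    -- `y ≥ 2`). The exponent of `r` in the product is then 1 or 2, not a multiple of 3.
    have hle : ∑ t ∈ T, t.factorization r ≤ 2 := by
      calc _ ≤ ∑ t ∈ T, if t ∈ ({r, r * 2} : Finset ℕ) then 1 else 0 := by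
            refine sum_le_sum fun t ht => ?_
            rcases hcases t ht with h | ⟨p, hp, -, h⟩ | ⟨e, he, h⟩
            · rw [h.1.factorization, Finsupp.single_apply]
              split_ifs with h1 h2
              · exact le_rfl
              · exact absurd (by simp [h1]) h2
              all_goals omega
            · rw [h, factorization_mul_primes hp Nat.prime_two, if_neg (by omega : ¬ 2 = r)]
              split_ifs with h1 h2
              · exact le_rfl
              · exact absurd (by simp [h1]) h2
              all_goals omega
            · have := hEB e he
              rw [h, factorization_mul_primes this.1.1 this.2.1, if_neg (by omega),
                if_neg (by omega)]
              omega
        _ ≤ ({r, r * 2} : Finset ℕ).card := by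
            rw [← card_filter]
            exact card_le_card fun t ht => (mem_filter.1 ht).2
        _ ≤ 2 := card_le_two
    have hge : 0 < ∑ t ∈ T, t.factorization r :=
      sum_pos' (fun _ _ => Nat.zero_le _) ⟨t, ht, Nat.pos_of_ne_zero htr⟩
    have := hdvd r
    omega
  have hTE : ∀ t ∈ T, ∃ e ∈ E, t = e.1 * e.2 := by
    intro t ht
    rcases hcases t ht with h | ⟨p, hp, hyp, h⟩ | h
    · refine (hlarge t h.1 h.2 t ht ?_).elim
      rw [h.1.factorization]; simp
    · refine (hlarge p hp hyp t ht ?_).elim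
      rw [h, factorization_mul_primes hp Nat.prime_two]; simp
    · exact h
  have hcross : ∀ e ∈ E, ∀ f ∈ E, e.1 ≠ f.2 := fun e he f hf h =>
    disjoint_left.1 hBS (mem_product.1 (hE he)).1 (h ▸ (mem_product.1 (hE hf)).2)
  have hmulinj : Set.InjOn (fun e : ℕ × ℕ => e.1 * e.2) E :=
    (injOn_mul_of_primes (fun p hp => (hB p hp).1) (fun p hp => (hS p hp).1) hBS).mono
      (by exact_mod_cast hE)
  set T' := E.filter fun e => e.1 * e.2 ∈ T with hT'
  have hT'E : ∀ e ∈ T', e ∈ E := fun e he => (mem_filter.1 he).1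
  have hmulinj' : Set.InjOn (fun e : ℕ × ℕ => e.1 * e.2) T' :=
    hmulinj.mono fun e he => hT'E e he
  have himage : T'.image (fun e => e.1 * e.2) = T := by
    ext t
    refine ⟨fun h => ?_, fun h => ?_⟩
    · obtain ⟨e, he, rfl⟩ := mem_image.1 h
      exact (mem_filter.1 he).2
    · obtain ⟨e, he, rfl⟩ := hTE t h
      exact mem_image.2 ⟨e, mem_filter.2 ⟨he, h⟩, rfl⟩
  have hT'card : T'.card = 9 := by
    rw [← hcard, ← himage, card_image_of_injOn hmulinj']
  have hsum : ∀ r, ∑ t ∈ T, t.factorization r =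
      ∑ e ∈ T', ((if e.1 = r then 1 else 0) + if e.2 = r then 1 else 0) := by
    intro r
    rw [← himage, sum_image hmulinj']
    exact sum_congr rfl fun e he =>
      factorization_mul_primes (hEB e (hT'E e he)).1.1 (hEB e (hT'E e he)).2.1 r
  -- As `B` and `S` are disjoint, the exponent of a prime is exactly its degree on its own side.
  obtain ⟨L, R, hL, hR, hLR⟩ := exists_k33_of_three_dvd_degrees hT'card
    (fun e he => by
      have := hdvd e.1
      rw [hsum, sum_congr rfl fun f hf => by
        rw [if_neg (hcross e (hT'E e he) f (hT'E f hf)).symm, add_zero], ← card_filter] at this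
      exact this)
    (fun e he => by
      have := hdvd e.2
      rw [hsum, sum_congr rfl fun f hf => by
        rw [if_neg (hcross f (hT'E f hf) e (hT'E e he)), zero_add], ← card_filter] at this
      exact this)
  exact hfree L R hL hR (hLR.trans (filter_subset _ _))

lemma card_le_maxSizeF {k d n : ℕ} {A : Finset ℕ} (hA : A ⊆ Icc 1 n)
    (hP : PropertyP k d (A : Set ℕ)) : A.card ≤ maxSizeF k d n := by
  classical
  rw [maxSizeF]
  refine le_sup (f := Finset.card) ?_
  simpa using ⟨hA, hP⟩

lemma primeCounting_le_add_card (y n : ℕ) :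
    Nat.primeCounting n ≤ y + ((Ioc y n).filter Nat.Prime).card := by
  rw [Nat.primeCounting, Nat.primeCounting', Nat.count_eq_card_filter_range]
  calc _ ≤ (Icc 1 y ∪ (Ioc y n).filter Nat.Prime).card := by
        refine card_le_card fun p hp => ?_
        obtain ⟨h1, h2⟩ := mem_filter.1 hp
        have := h2.one_le
        have := mem_range.1 h1
        by_cases hpy : p ≤ y
        · exact mem_union_left _ (mem_Icc.2 ⟨by omega, hpy⟩)
        · exact mem_union_right _ (mem_filter.2 ⟨mem_Ioc.2 ⟨by omega, by omega⟩, h2⟩)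
    _ ≤ _ := (card_union_le _ _).trans (by simp)

/-- The loss `2 * y` pays for the primes up to `y` missing from each of the two prime families. -/
lemma primeCounting_add_card_le_maxSizeF {y n : ℕ} (hy : 2 ≤ y) {B S : Finset ℕ}
    {E : Finset (ℕ × ℕ)} (hB : ∀ p ∈ B, p.Prime ∧ p ≤ y) (hS : ∀ p ∈ S, p.Prime ∧ p ≤ y)
    (hBS : Disjoint B S) (hE : E ⊆ B ×ˢ S) (hfree : K33Free E) (hn : ∀ e ∈ E, e.1 * e.2 ≤ n) :
    Nat.primeCounting n + Nat.primeCounting (n / 2) + E.card ≤ maxSizeF 9 3 n + 2 * y := by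
  set P := (Ioc y n).filter Nat.Prime with hPdef
  set Q := (Ioc y (n / 2)).filter Nat.Prime with hQdef
  have hP : ∀ p ∈ P, p.Prime ∧ y < p := fun p hp =>
    ⟨(mem_filter.1 hp).2, (mem_Ioc.1 (mem_filter.1 hp).1).1⟩
  have hQ : ∀ p ∈ Q, p.Prime ∧ y < p := fun p hp =>
    ⟨(mem_filter.1 hp).2, (mem_Ioc.1 (mem_filter.1 hp).1).1⟩
  have hEB : ∀ e ∈ E, (e.1.Prime ∧ e.1 ≤ y) ∧ (e.2.Prime ∧ e.2 ≤ y) := fun e he =>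
    ⟨hB _ (mem_product.1 (hE he)).1, hS _ (mem_product.1 (hE he)).2⟩
  have hprop := propertyP_nine_three hy hP hQ hB hS hBS hE hfree
  have hinj : Set.InjOn (fun e : ℕ × ℕ => e.1 * e.2) E :=
    (injOn_mul_of_primes (fun p hp => (hB p hp).1) (fun p hp => (hS p hp).1) hBS).mono
      (by exact_mod_cast hE)
  have hsub : P ∪ Q.image (2 * ·) ∪ E.image (fun e => e.1 * e.2) ⊆ Icc 1 n := by
    intro t ht
    simp only [mem_union, mem_image] at ht
    rcases ht with (h | ⟨p, h, rfl⟩) | ⟨e, h, rfl⟩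
    · have := mem_Ioc.1 (mem_filter.1 h).1
      exact mem_Icc.2 ⟨by omega, this.2⟩
    · have := mem_Ioc.1 (mem_filter.1 h).1
      exact mem_Icc.2 ⟨by omega, by omega⟩
    · exact mem_Icc.2 ⟨Nat.mul_pos (hEB e h).1.1.pos (hEB e h).2.1.pos, hn e h⟩
  have hd1 : Disjoint P (Q.image (2 * ·)) := by
    rw [disjoint_left]
    intro p hp hp'
    obtain ⟨p', hp'', rfl⟩ := mem_image.1 hp'
    exact Nat.not_prime_mul (by omega) (hQ p' hp'').1.one_lt.ne' (hP _ hp).1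
  have hd2 : Disjoint (P ∪ Q.image (2 * ·)) (E.image fun e => e.1 * e.2) := by
    rw [disjoint_left]
    intro t ht ht'
    obtain ⟨e, he, rfl⟩ := mem_image.1 ht'
    have hee := hEB e he
    obtain ⟨r, hr, hyr, hrd⟩ : ∃ r, r.Prime ∧ y < r ∧ r ∣ e.1 * e.2 := by
      rcases mem_union.1 ht with h | h
      · exact ⟨_, (hP _ h).1, (hP _ h).2, dvd_rfl⟩
      · obtain ⟨p, hp, h⟩ := mem_image.1 h
        exact ⟨p, (hQ p hp).1, (hQ p hp).2, Dvd.intro_left 2 h⟩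
    rcases hr.dvd_mul.1 hrd with h | h
    · have := (Nat.prime_dvd_prime_iff_eq hr hee.1.1).1 h
      omega
    · have := (Nat.prime_dvd_prime_iff_eq hr hee.2.1).1 h
      omega
  have hcard := card_le_maxSizeF hsub hprop
  rw [card_union_of_disjoint hd2, card_union_of_disjoint hd1, card_image_of_injOn hinj,
    card_image_of_injective _ (mul_right_injective₀ two_ne_zero)] at hcard
  have h1 := primeCounting_le_add_card y n
  have h2 := primeCounting_le_add_card y (n / 2)
  rw [← hPdef] at h1
  rw [← hQdef] at h2
  omega

/-! ### Primes near `√n` and the lower bound. -/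

lemma theta_sub_theta_le {a b : ℕ} (hab : a ≤ b) :
    Chebyshev.theta b - Chebyshev.theta a ≤ ((Ioc a b).filter Nat.Prime).card * Real.log b := by
  have hs : (Ioc 0 b).filter Nat.Prime = (Ioc 0 a).filter Nat.Prime ∪ (Ioc a b).filter Nat.Prime := by
    rw [← filter_union, Ioc_union_Ioc_eq_Ioc (Nat.zero_le a) hab]
  have hd : Disjoint ((Ioc 0 a).filter Nat.Prime) ((Ioc a b).filter Nat.Prime) := by
    refine disjoint_filter_filter ?_
    rw [disjoint_left]; intro x; simp only [mem_Ioc]; omega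
  rw [Chebyshev.theta, Chebyshev.theta, Nat.floor_natCast, Nat.floor_natCast, hs, sum_union hd,
    add_sub_cancel_left, ← nsmul_eq_mul, ← sum_const]
  refine sum_le_sum fun p hp => ?_
  obtain ⟨h1, h2⟩ := mem_filter.1 hp
  exact Real.log_le_log (by exact_mod_cast h2.pos) (by exact_mod_cast (mem_Ioc.1 h1).2)

open Filter in
lemma eventually_exists_prime_mul :
    ∀ᶠ y : ℝ in atTop, ∃ q : ℕ, q.Prime ∧ 1.08 * y ≤ q ∧ (q : ℝ) ≤ 1.35 * y := by
  have h1 : Tendsto (fun y : ℝ => ⌊1.08 * y⌋₊) atTop atTop :=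
    tendsto_nat_floor_atTop.comp (tendsto_id.const_mul_atTop (by norm_num))
  have h2 : Tendsto (fun y : ℝ => ⌊1.35 * y⌋₊) atTop atTop :=
    tendsto_nat_floor_atTop.comp (tendsto_id.const_mul_atTop (by norm_num))
  filter_upwards [h1.eventually eventually_theta_bounds, h2.eventually eventually_theta_bounds,
    eventually_ge_atTop 100] with y a b hy
  have hlt : ⌊1.08 * y⌋₊ ≤ ⌊1.35 * y⌋₊ := Nat.floor_le_floor (by linarith)
  have hc := theta_sub_theta_le hlt
  have e1 := Nat.floor_le (show 0 ≤ 1.08 * y by linarith)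
  have e2 := Nat.lt_floor_add_one (1.35 * y)
  -- The margin is `0.915 * 1.35 > 1.12 * 1.08`.
  have hne : ((Ioc ⌊1.08 * y⌋₊ ⌊1.35 * y⌋₊).filter Nat.Prime).Nonempty := by
    rw [nonempty_iff_ne_empty]
    intro h0
    rw [h0] at hc
    simp only [card_empty, Nat.cast_zero, zero_mul] at hc
    linarith [a.2, b.1]
  obtain ⟨q, hq⟩ := hne
  obtain ⟨hq1, hq2⟩ := mem_filter.1 hq
  obtain ⟨hq3, hq4⟩ := mem_Ioc.1 hq1
  exact ⟨q, hq2, (Nat.lt_of_floor_lt hq3).le, (Nat.le_floor_iff (by linarith)).1 hq4⟩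

open Filter in
/-- The numbers of primes in `(√n / 2, 2√n]` and up to `√n / 2`. -/
lemma eventually_card_primes_near_sqrt :
    ∀ᶠ n : ℕ in atTop,
      1.2 * (2 * Real.sqrt n / Real.log n) ≤
        ((Ioc (Nat.sqrt n / 2) (2 * Nat.sqrt n)).filter Nat.Prime).card ∧
      0.45 * (2 * Real.sqrt n / Real.log n) ≤
        ((Ioc 0 (Nat.sqrt n / 2)).filter Nat.Prime).card := by
  have hs : Tendsto Nat.sqrt atTop atTop :=
    tendsto_atTop_atTop.2 fun b => ⟨b * b, fun a ha => Nat.le_sqrt.2 ha⟩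
  have hs2 : Tendsto (fun n => 2 * Nat.sqrt n) atTop atTop :=
    hs.const_mul_atTop' (by norm_num)
  have hsh : Tendsto (fun n => Nat.sqrt n / 2) atTop atTop :=
    (Nat.tendsto_div_const_atTop (by norm_num)).comp hs
  have hlog : Tendsto (fun n : ℕ => Real.log n) atTop atTop :=
    Real.tendsto_log_atTop.comp tendsto_natCast_atTop_atTop
  filter_upwards [hs2.eventually eventually_theta_bounds, hsh.eventually eventually_theta_bounds,
    hlog.eventually_ge_atTop 100, hs.eventually_ge_atTop 1000] with n h2 hh hL hs1000
  have hsq1 : (Nat.sqrt n : ℝ) ≤ Real.sqrt n := Real.nat_sqrt_le_real_sqrt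
  have hsq2 : Real.sqrt n ≤ Nat.sqrt n + 1 := Real.real_sqrt_le_nat_sqrt_succ
  have hlogs : Real.log (Real.sqrt n) = Real.log n / 2 := Real.log_sqrt (Nat.cast_nonneg n)
  set s := Nat.sqrt n
  set u := Real.sqrt n
  set l := Real.log n
  have hs1 : (1000 : ℝ) ≤ s := by exact_mod_cast hs1000
  have hh1 : ((s / 2 : ℕ) : ℝ) ≤ (s : ℝ) / 2 := by
    simpa using (Nat.cast_div_le (α := ℝ) (m := s) (n := 2))
  have hh2 : (s : ℝ) ≤ 2 * ((s / 2 : ℕ) : ℝ) + 1 := by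
    have : s ≤ 2 * (s / 2) + 1 := by omega
    exact_mod_cast this
  have hl0 : 0 < l := by linarith
  have hu0 : 0 < u := by linarith
  constructor
  · have h := theta_sub_theta_le (a := s / 2) (b := 2 * s) (by omega)
    have hlog2 : Real.log ((2 * s : ℕ) : ℝ) ≤ 1.05 * (l / 2) := by
      push_cast
      rw [Real.log_mul (by norm_num) (by linarith)]
      have h3 : Real.log s ≤ l / 2 := by
        rw [← hlogs]; exact Real.log_le_log (by linarith) hsq1
      linarith [Real.log_two_lt_d9]
    have h2' : ((2 * s : ℕ) : ℝ) = 2 * s := by push_cast; rfl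
    -- From `2 * 0.915 - 1.12 / 2 = 1.27`, with room for rounding.
    have h4 : 1.26 * u ≤ ((Ioc (s / 2) (2 * s)).filter Nat.Prime).card * (1.05 * (l / 2)) := by
      calc 1.26 * u ≤ _ := by linarith [hh.2, h2.1]
        _ ≤ _ := mul_le_mul_of_nonneg_left hlog2 (Nat.cast_nonneg _)
    rw [mul_div_assoc', div_le_iff₀ hl0]
    linarith
  · have h := theta_sub_theta_le (a := 0) (b := s / 2) (by omega)
    have hlog2 : Real.log ((s / 2 : ℕ) : ℝ) ≤ l / 2 := by
      rw [← hlogs]; exact Real.log_le_log (by linarith) (by linarith)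
    have h4 : 0.45 * u ≤ ((Ioc 0 (s / 2)).filter Nat.Prime).card * (l / 2) := by
      calc 0.45 * u ≤ _ := by
            rw [Nat.cast_zero, Chebyshev.theta_zero] at h
            linarith [hh.1]
        _ ≤ _ := mul_le_mul_of_nonneg_left hlog2 (Nat.cast_nonneg _)
    rw [mul_div_assoc', div_le_iff₀ hl0]
    linarith

/-- A `K_{3,3}`-free set of products of two primes near `√n` of size `≥ 0.395 Y⁵`, where
`Y³ = 2√n / log n`. -/
lemma edges_card_ge {B S : Finset ℕ} {Y : ℝ} {q : ℕ} (hY : 100 ≤ Y) (hq : q.Prime)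
    (hq1 : 1.08 * Y ≤ q) (hq2 : (q : ℝ) ≤ 1.35 * Y) (hB : 1.2 * Y ^ 3 ≤ B.card)
    (hS : 0.45 * Y ^ 3 ≤ S.card) :
    ∃ E ⊆ B ×ˢ S, K33Free E ∧ 0.395 * Y ^ 5 ≤ E.card := by
  have hY0 : 0 < Y := by linarith
  have hY3 : (1000000 : ℝ) ≤ Y ^ 3 := by
    calc (1000000 : ℝ) = 100 ^ 3 := by norm_num
      _ ≤ Y ^ 3 := by gcongr
  obtain ⟨B', hB', hB'c⟩ := exists_subset_card_eq (s := B) (n := ⌊1.2 * Y ^ 3⌋₊)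
    (Nat.floor_le_of_le hB)
  obtain ⟨S', hS', hS'c⟩ := exists_subset_card_eq (s := S) (n := ⌊0.45 * Y ^ 3⌋₊)
    (Nat.floor_le_of_le hS)
  -- This is why `q ≥ 1.08 * Y`: both sides must fit into the norm graph. The upper bound on `q`
  -- then gives about `1.2 * 0.45 / 1.35 = 0.4` times `Y ^ 5` edges.
  have hcap : 1.2 * Y ^ 3 ≤ ((q ^ 2 * (q - 1) : ℕ) : ℝ) := by
    rw [Nat.cast_mul, Nat.cast_pow, Nat.cast_sub hq.one_le, Nat.cast_one]
    calc 1.2 * Y ^ 3 ≤ (1.08 * Y) ^ 2 * (1.08 * Y - 1) := by nlinarith [sq_nonneg Y]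
      _ ≤ _ := by
        gcongr
        linarith
  have hB1 : B'.card ≤ q ^ 2 * (q - 1) := by
    rw [hB'c]; exact Nat.floor_le_of_le hcap
  have hS1 : S'.card ≤ q ^ 2 * (q - 1) := by
    rw [hS'c]; exact Nat.floor_le_of_le (by linarith)
  obtain ⟨E, hE, hfree, hcard⟩ := exists_k33Free_subset hq B' S' hB1 hS1
  refine ⟨E, hE.trans (product_subset_product hB' hS'), hfree, ?_⟩
  have hb : 1.1999 * Y ^ 3 ≤ B'.card := by
    rw [hB'c]; have := Nat.lt_floor_add_one (1.2 * Y ^ 3); linarith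
  have hs : 0.4499 * Y ^ 3 ≤ S'.card := by
    rw [hS'c]; have := Nat.lt_floor_add_one (0.45 * Y ^ 3); linarith
  have hc : (B'.card : ℝ) * S'.card ≤ E.card * q := by exact_mod_cast hcard
  have hchain : (0.395 * Y ^ 5) * (1.35 * Y) ≤ E.card * (1.35 * Y) := by
    calc (0.395 * Y ^ 5) * (1.35 * Y) = 0.53325 * (Y ^ 3) ^ 2 := by ring
      _ ≤ (1.1999 * Y ^ 3) * (0.4499 * Y ^ 3) := by nlinarith [sq_nonneg (Y ^ 3)]
      _ ≤ B'.card * S'.card := by gcongr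
      _ ≤ E.card * q := hc
      _ ≤ _ := by gcongr
  exact le_of_mul_le_mul_right hchain (by positivity)

open Filter in
lemma eventually_log_le_rpow_tenth :
    ∀ᶠ n : ℕ in atTop, Real.log n ≤ (n : ℝ) ^ (1 / 10 : ℝ) := by
  filter_upwards [tendsto_natCast_atTop_atTop.eventually
    ((isLittleO_log_rpow_atTop (r := 1 / 10) (by norm_num)).bound one_pos)] with n hn
  rw [one_mul, Real.norm_eq_abs, Real.norm_eq_abs,
    abs_of_nonneg (Real.rpow_nonneg (Nat.cast_nonneg n) _)] at hn
  exact (le_abs_self _).trans hn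

open Filter in
theorem eventually_lt_maxSizeF_nine_three :
    ∀ᶠ n : ℕ in atTop, (n : ℝ) ^ (5 / 6 : ℝ) / Real.log (n : ℝ) ^ (5 / 3 : ℝ) <
      (maxSizeF 9 3 n : ℝ) -
        ((Nat.primeCounting n : ℝ) + (Nat.primeCounting (n / 2) : ℝ)) := by
  obtain ⟨Y₀, hY₀⟩ := eventually_atTop.1 eventually_exists_prime_mul
  have hbig : Tendsto (fun n : ℕ => (n : ℝ) ^ (2 / 15 : ℝ)) atTop atTop :=
    (tendsto_rpow_atTop (by norm_num)).comp tendsto_natCast_atTop_atTop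
  have hbig' : Tendsto (fun n : ℕ => (n : ℝ) ^ (1 / 6 : ℝ)) atTop atTop :=
    (tendsto_rpow_atTop (by norm_num)).comp tendsto_natCast_atTop_atTop
  have hlog : Tendsto (fun n : ℕ => Real.log n) atTop atTop :=
    Real.tendsto_log_atTop.comp tendsto_natCast_atTop_atTop
  filter_upwards [eventually_card_primes_near_sqrt, eventually_log_le_rpow_tenth,
    hbig.eventually_ge_atTop (max Y₀ 100), hbig'.eventually_ge_atTop 80,
    hlog.eventually_ge_atTop 1, eventually_ge_atTop 4] with n hcard hlog10 hn1 hn2 hl1 hn4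
  have hn0 : (0 : ℝ) < n := by exact_mod_cast (by omega : 0 < n)
  have hl0 : 0 < Real.log n := by linarith
  set X := 2 * Real.sqrt n / Real.log n with hX
  have hsqrt : Real.sqrt n = (n : ℝ) ^ (1 / 2 : ℝ) := Real.sqrt_eq_rpow _
  have hX1 : (n : ℝ) ^ (2 / 5 : ℝ) ≤ X := by
    rw [hX, le_div_iff₀ hl0, hsqrt]
    calc (n : ℝ) ^ (2 / 5 : ℝ) * Real.log n ≤ (n : ℝ) ^ (2 / 5 : ℝ) * (n : ℝ) ^ (1 / 10 : ℝ) := by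
          gcongr
      _ = (n : ℝ) ^ (1 / 2 : ℝ) := by rw [← Real.rpow_add hn0]; norm_num
      _ ≤ _ := by have : 0 ≤ (n : ℝ) ^ (1 / 2 : ℝ) := by positivity
                  linarith
  have hX0 : 0 < X := by rw [hX]; positivity
  set Y := X ^ (1 / 3 : ℝ) with hY
  have hY3 : Y ^ 3 = X := by
    rw [hY, ← Real.rpow_natCast, ← Real.rpow_mul hX0.le]; norm_num
  have hY1 : (n : ℝ) ^ (2 / 15 : ℝ) ≤ Y := by
    calc (n : ℝ) ^ (2 / 15 : ℝ) = ((n : ℝ) ^ (2 / 5 : ℝ)) ^ (1 / 3 : ℝ) := by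
          rw [← Real.rpow_mul hn0.le]; norm_num
      _ ≤ _ := by rw [hY]; gcongr
  have hY0 : 0 < Y := by rw [hY]; positivity
  have hY100 : 100 ≤ Y := (le_max_right _ _).trans (hn1.trans hY1)
  obtain ⟨q, hq, hq1, hq2⟩ := hY₀ Y ((le_max_left _ _).trans (hn1.trans hY1))
  rw [← hY3] at hcard
  obtain ⟨E, hE, hfree, hEcard⟩ := edges_card_ge hY100 hq hq1 hq2 hcard.1 hcard.2
  have hs2 : 2 ≤ Nat.sqrt n := Nat.le_sqrt.2 hn4
  have hmain := primeCounting_add_card_le_maxSizeF (n := n) (y := 2 * Nat.sqrt n) (by omega)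
    (fun p hp => ⟨(mem_filter.1 hp).2, (mem_Ioc.1 (mem_filter.1 hp).1).2⟩)
    (fun p hp => ⟨(mem_filter.1 hp).2, by
      have := (mem_Ioc.1 (mem_filter.1 hp).1).2
      omega⟩)
    (disjoint_filter_filter (by
      rw [disjoint_left]; intro x; simp only [mem_Ioc]; omega)) hE hfree (fun e he => by
      obtain ⟨h1, h2⟩ := mem_product.1 (hE he)
      have h3 := (mem_Ioc.1 (mem_filter.1 h1).1).2
      have h4 := (mem_Ioc.1 (mem_filter.1 h2).1).2
      calc e.1 * e.2 ≤ 2 * Nat.sqrt n * (Nat.sqrt n / 2) := Nat.mul_le_mul h3 h4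
        _ = Nat.sqrt n * (2 * (Nat.sqrt n / 2)) := by ring
        _ ≤ Nat.sqrt n * Nat.sqrt n := Nat.mul_le_mul_left _ (Nat.mul_div_le _ _)
        _ ≤ n := Nat.sqrt_le n)
  have hmain' : (Nat.primeCounting n : ℝ) + Nat.primeCounting (n / 2) + E.card ≤
      maxSizeF 9 3 n + 2 * (2 * Nat.sqrt n) := by exact_mod_cast hmain
  have hY5 : Y ^ 5 = X ^ (5 / 3 : ℝ) := by
    rw [hY, ← Real.rpow_natCast, ← Real.rpow_mul hX0.le]; norm_num
  -- The factor `2^(5/3) ≥ 3.125 = 1 / 0.32` comes from `Y ^ 3 = 2√n / log n`. The final comparison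
  -- is `0.395 - 4 / 80 > 0.32`, where `4√n` is the loss `2 * y`.
  have hlhs : (n : ℝ) ^ (5 / 6 : ℝ) / Real.log n ^ (5 / 3 : ℝ) ≤ 0.32 * Y ^ 5 := by
    have h2 : (3.125 : ℝ) ≤ 2 ^ (5 / 3 : ℝ) := by
      calc (3.125 : ℝ) = (3.125 ^ (3 : ℕ)) ^ (1 / 3 : ℝ) := by
            rw [← Real.rpow_natCast, ← Real.rpow_mul (by norm_num)]; norm_num
        _ ≤ (2 ^ (5 : ℕ)) ^ (1 / 3 : ℝ) := by gcongr; norm_num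
        _ = _ := by rw [← Real.rpow_natCast, ← Real.rpow_mul (by norm_num)]; norm_num
    have h3 : X ^ (5 / 3 : ℝ) = 2 ^ (5 / 3 : ℝ) *
        ((n : ℝ) ^ (5 / 6 : ℝ) / Real.log n ^ (5 / 3 : ℝ)) := by
      rw [hX, hsqrt, Real.div_rpow (by positivity) hl0.le, Real.mul_rpow (by norm_num)
        (by positivity), ← Real.rpow_mul hn0.le, mul_div_assoc]
      norm_num
    rw [hY5, h3]
    have h4 : 0 ≤ (n : ℝ) ^ (5 / 6 : ℝ) / Real.log n ^ (5 / 3 : ℝ) := by positivity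
    nlinarith
  have hsmall : 80 * Real.sqrt n ≤ Y ^ 5 := by
    calc 80 * Real.sqrt n ≤ (n : ℝ) ^ (1 / 6 : ℝ) * (n : ℝ) ^ (1 / 2 : ℝ) := by
          rw [hsqrt]; gcongr
      _ = ((n : ℝ) ^ (2 / 5 : ℝ)) ^ (5 / 3 : ℝ) := by
          rw [← Real.rpow_add hn0, ← Real.rpow_mul hn0.le]; norm_num
      _ ≤ _ := by rw [hY5]; gcongr
  have hsq : (Nat.sqrt n : ℝ) ≤ Real.sqrt n := Real.nat_sqrt_le_real_sqrt
  have hY5pos : 0 < Y ^ 5 := by positivity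
  linarith

theorem mainTheorem9 :
    (∃ N : ℕ, ∀ n : ℕ, N ≤ n →
      (n : ℝ) ^ (5 / 6 : ℝ) / Real.log (n : ℝ) ^ (5 / 3 : ℝ) <
        (maxSizeF 9 3 n : ℝ) - ((Nat.primeCounting n : ℝ) + (Nat.primeCounting (n / 2) : ℝ))) ∧
    (∃ C : ℝ, 0 < C ∧ ∀ n : ℕ, 1 ≤ n →
      (maxSizeF 9 3 n : ℝ) - ((Nat.primeCounting n : ℝ) + (Nat.primeCounting (n / 2) : ℝ)) ≤
        C * (n : ℝ) ^ (5 / 6 : ℝ)) :=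
  ⟨Filter.eventually_atTop.1 eventually_lt_maxSizeF_nine_three,
    8757, by norm_num, fun _ hn => maxSizeF_nine_three_le hn⟩
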